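/- Fix integers $r\ge1$, $k_0\ge1$ and $\delta\in[0,1]$. Consider a sequence of models indexed by $m\to\infty$, with sample size $n=n_m\to\infty$ and dimension $p=p_m\to\infty$; the index $m$ is suppressed. In each model $$\mathbf y_t=\mathbf A\mathbf x_t+\boldsymbol\varepsilon_t,\qquad t\in\mathbb Z,$$ where $\mathbf y_t\in\mathbb R^p$ is observed for $t=1,\dots,n$, $\mathbf x_t\in\mathbb R^r$ is the factor process, and $\mathbf A$ is a constant $p\times r$ matrix. Write $\Sigma_y(k)=\mathrm{cov}(\mathbf y_{t+k},\mathbf y_t)$, $\Sigma_x(k)=\mathrm{cov}(\mathbf x_{t+k},\mathbf x_t)$, $\Sigma_{x\varepsilon}(k)=\mathrm{cov}(\mathbf x_{t+k},\boldsymbol\varepsilon_t)$. Let $\lambda_1\ge\dots\ge\lambda_p$ be the eigenvalues of $\mathbf M=\sum_{k=1}^{k_0}\Sigma_y(k)\Sigma_y(k)'$, and let $\hat\lambda_1\ge\dots\ge\hat\lambda_p$ be those of $\hat{\mathbf M}=\sum_{k=1}^{k_0}\hat\Sigma_y(k)\hat\Sigma_y(k)'$, where $\hat\Sigma_y(k)=n^{-1}\sum_{t=1}^{n-k}(\mathbf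 y_{t+k}-\bar{\mathbf y})(\mathbf y_t-\bar{\mathbf y})'$ and $\bar{\mathbf y}=n^{-1}\sum_{t=1}^n\mathbf y_t$. For a matrix $G$, $\|G\|$ and $\|G\|_{\min}$ denote the square roots of the largest and of the smallest nonzero eigenvalue of $GG'$; $a\asymp b$ means $a=O(b)$ and $b=O(a)$. Assume: (C1) $\boldsymbol\varepsilon_t$ is a vector white noise (square integrable, constant mean and covariance matrix, uncorrelated over time), $\mathbf A'\mathbf A=\mathbf I_r$, and whenever $\mathbf c'\mathbf x_t$ is white noise for a constant $\mathbf c\in\mathbb R^r$, then $\mathbf c'\,\mathrm{cov}(\mathbf x_{t+k},\boldsymbol\varepsilon_t)=0$ for all integers $k\ne0$. (C2) $\mathbf x_t$ is weakly stationary, and $\mathrm{cov}(\mathbf x_t,\boldsymbol\varepsilon_{t+k})=0$ for all $k\ge0$. (C3) $\mathbf y_t$ is strictly stationary and $\psi$-mixing, with coefficients $\psi(k)=\sup|1-P(B\mid A)/P(B)|$ (the supremum over events $A\in\sigma(\mathbf y_t,t\le0)$, $B\in\sigma(\mathbf y_t,t\ge k)$ of positive probability); the sum $\sum_{t\ge1}t\,\psi(t)^{1/2}$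 and the fourth moments $E|y_{jt}|^4$ of all entries are finite, with bounds that do not depend on the model (in particular not on $p$) nor on $j,t$. (C4) $\lambda_1>\dots>\lambda_r>0=\lambda_{r+1}=\dots=\lambda_p$. (C5) For $k=1,\dots,k_0$, $\Sigma_x(k)$ is nonsingular and $\|\Sigma_x(k)\|\asymp p^{1-\delta}\asymp\|\Sigma_x(k)\|_{\min}$. (C6) For $k=0,1,\dots,k_0$, $\|\Sigma_{x\varepsilon}(k)\|=o(p^{1-\delta})$. Assume also $h_n=p^{\delta}n^{-1/2}\to0$. Then: (i) with probability tending to one, $\hat\lambda_1,\dots,\hat\lambda_r$ are positive, so that the ratios below are well defined; (ii) $\hat\lambda_{j+1}/\hat\lambda_j\asymp1$ in probability for $j=1,\dots,r-1$: there are constants $0<c\le C<\infty$ such that $P(c\le\hat\lambda_{j+1}/\hat\lambda_j\le C)\to1$; (iii) $\hat\lambda_{r+1}/\hat\lambda_r=O_P(p^{2\delta}/n)$, and $\hat\lambda_{r+1}/\hat\lambda_r\to0$ in probability. -/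

import Mathlib

open MeasureTheory ProbabilityTheory Filter Topology Asymptotics
open scoped ENNReal NNReal Matrix

noncomputable section

namespace FactorTS

/-! ### Matrix notions -/

/-- The `j`-th largest eigenvalue (`j = 1, ..., p`, counted with multiplicity) of a real
symmetric `p × p` matrix; it is set to `0` when `j` is outside `{1, ..., p}`. -/
def eig {p : ℕ} {S : Matrix (Fin p) (Fin p) ℝ} (hS : S.IsHermitian) (j : ℕ) : ℝ :=
  if h : 1 ≤ j ∧ j ≤ p then hS.eigenvalues₀ ⟨j - 1, by rw [Fintype.card_fin]; omega⟩ else 0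

section
open scoped Matrix.Norms.L2Operator

/-- The spectral norm `‖G‖` (the square root of the largest eigenvalue of `G Gᵀ`). -/
def specNorm {a b : ℕ} (G : Matrix (Fin a) (Fin b) ℝ) : ℝ := ‖G‖

end

/-- `‖G‖_min`, the square root of the smallest nonzero eigenvalue of `G Gᵀ`
(equal to `0` if `G = 0`). -/
def minNorm {a b : ℕ} (G : Matrix (Fin a) (Fin b) ℝ) : ℝ :=
  √(sInf (spectrum ℝ (G * Gᵀ) \ {0}))

/-- `∑_{k=1}^{k₀} S(k) S(k)ᵀ`. -/
def sumSq {p : ℕ} (k₀ : ℕ) (S : ℕ → Matrix (Fin p) (Fin p) ℝ) : Matrix (Fin p) (Fin p) ℝ :=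
  ∑ k ∈ Finset.Icc 1 k₀, S k * (S k)ᵀ

theorem sumSq_isHermitian {p : ℕ} (k₀ : ℕ) (S : ℕ → Matrix (Fin p) (Fin p) ℝ) :
    (sumSq k₀ S).IsHermitian := by
  unfold Matrix.IsHermitian sumSq
  rw [Matrix.conjTranspose_sum]
  refine Finset.sum_congr rfl fun k _ => ?_
  rw [Matrix.conjTranspose_eq_transpose_of_trivial, Matrix.transpose_mul,
    Matrix.transpose_transpose]

/-! ### Time series -/

section TimeSeries

variable {Ω : Type*} [MeasurableSpace Ω]

/-- The cross-covariance matrix `cov(U, V) = (cov(U_i, V_j))_{i,j}` of two random vectors. -/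
def covMat {a b : ℕ} (P : Measure Ω) (U : Ω → Fin a → ℝ) (V : Ω → Fin b → ℝ) :
    Matrix (Fin a) (Fin b) ℝ :=
  Matrix.of fun i j => cov[fun ω => U ω i, fun ω => V ω j; P]

/-- `e` is a vector white noise `WN(μ, S)`: square integrable, with constant mean `μ`, constant
covariance matrix `S`, and uncorrelated at distinct times. -/
structure IsWhiteNoise {d : ℕ} (P : Measure Ω) (e : ℤ → Ω → Fin d → ℝ)
    (μ : Fin d → ℝ) (S : Matrix (Fin d) (Fin d) ℝ) : Prop where
  memLp : ∀ t i, MemLp (fun ω => e t ω i) 2 P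
  mean : ∀ t i, ∫ ω, e t ω i ∂P = μ i
  cov_self : ∀ t, covMat P (e t) (e t) = S
  cov_ne : ∀ s t, s ≠ t → covMat P (e s) (e t) = 0

/-- Weak (second order) stationarity. -/
structure IsWeaklyStationary {d : ℕ} (P : Measure Ω) (x : ℤ → Ω → Fin d → ℝ) : Prop where
  memLp : ∀ t i, MemLp (fun ω => x t ω i) 2 P
  mean : ∀ t i, ∫ ω, x t ω i ∂P = ∫ ω, x 0 ω i ∂P
  cov : ∀ t k, covMat P (x (t + k)) (x t) = covMat P (x k) (x 0)

/-- Strict stationarity: the law of the whole process is invariant under time shifts. -/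
def IsStrictlyStationary {d : ℕ} (P : Measure Ω) (y : ℤ → Ω → Fin d → ℝ) : Prop :=
  ∀ h : ℤ, P.map (fun ω (t : ℤ) => y (t + h) ω) = P.map (fun ω (t : ℤ) => y t ω)

/-- The σ-algebra generated by `y_t`, `t ≤ 0`. -/
abbrev past {d : ℕ} (y : ℤ → Ω → Fin d → ℝ) : MeasurableSpace Ω :=
  ⨆ (t : ℤ) (_ : t ≤ 0), MeasurableSpace.comap (y t) inferInstance

/-- The σ-algebra generated by `y_t`, `t ≥ k`. -/
abbrev future {d : ℕ} (y : ℤ → Ω → Fin d → ℝ) (k : ℕ) : MeasurableSpace Ω :=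
  ⨆ (t : ℤ) (_ : (k : ℤ) ≤ t), MeasurableSpace.comap (y t) inferInstance

/-- The `ψ`-mixing coefficient `ψ(k) = sup |1 - P(B | A) / P(B)|`, over `A` in the past up to time
`0` and `B` in the future from time `k`, both of positive probability. Values in `[0, ∞]`. -/
def psiMix {d : ℕ} (P : Measure Ω) (y : ℤ → Ω → Fin d → ℝ) (k : ℕ) : ℝ≥0∞ :=
  ⨆ (A : Set Ω) (B : Set Ω) (_ : MeasurableSet[past y] A) (_ : MeasurableSet[future y k] B)
    (_ : P A ≠ 0) (_ : P B ≠ 0),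
    ENNReal.ofReal |1 - P.real (A ∩ B) / (P.real A * P.real B)|

/-- The lag-`k` autocovariance matrix `cov(z_{t+k}, z_t)` of a stationary process, taken at `t = 0`.
The population matrix `M = ∑_{k=1}^{k₀} Σ_y(k) Σ_y(k)ᵀ` is `sumSq k₀ (lagCov P y)`. -/
def lagCov {d : ℕ} (P : Measure Ω) (y : ℤ → Ω → Fin d → ℝ) (k : ℕ) :
    Matrix (Fin d) (Fin d) ℝ :=
  covMat P (y k) (y 0)

/-- The sample mean of `y_1, ..., y_n`. -/
def sampleMean {d : ℕ} (y : ℤ → Ω → Fin d → ℝ) (n : ℕ) (ω : Ω) : Fin d → ℝ :=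
  (n : ℝ)⁻¹ • ∑ t ∈ Finset.Icc 1 n, y t ω

/-- The lag-`k` sample autocovariance matrix
`n⁻¹ ∑_{t=1}^{n-k} (y_{t+k} - ȳ) (y_t - ȳ)ᵀ` of `y_1, ..., y_n`. -/
def sampleCov {d : ℕ} (y : ℤ → Ω → Fin d → ℝ) (n k : ℕ) (ω : Ω) : Matrix (Fin d) (Fin d) ℝ :=
  (n : ℝ)⁻¹ • ∑ t ∈ Finset.Icc 1 (n - k),
    Matrix.vecMulVec (y ((t : ℤ) + k) ω - sampleMean y n ω) (y t ω - sampleMean y n ω)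

/-- `λ_j`, the `j`-th largest eigenvalue of `M`. -/
def popEig {d : ℕ} (P : Measure Ω) (k₀ : ℕ) (y : ℤ → Ω → Fin d → ℝ) (j : ℕ) : ℝ :=
  eig (sumSq_isHermitian k₀ (lagCov P y)) j

/-- `λ̂_j`, the `j`-th largest eigenvalue of `M̂ = ∑_{k=1}^{k₀} Σ̂_y(k) Σ̂_y(k)ᵀ`. -/
def estEig {d : ℕ} (k₀ : ℕ) (y : ℤ → Ω → Fin d → ℝ) (n j : ℕ) (ω : Ω) : ℝ :=
  eig (sumSq_isHermitian k₀ (fun k => sampleCov y n k ω)) j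

/-- The factor model `y_t = A x_t + ε_t` with orthonormal loadings and white noise `ε`; a linear
combination of the factors that is white noise is uncorrelated with `ε` at all nonzero lags. -/
structure IsFactorModel {d r : ℕ} (P : Measure Ω) (y : ℤ → Ω → Fin d → ℝ)
    (A : Matrix (Fin d) (Fin r) ℝ) (x : ℤ → Ω → Fin r → ℝ) (ε : ℤ → Ω → Fin d → ℝ) : Prop where
  measurable : ∀ t, Measurable (y t)
  decomp : ∀ t ω, y t ω = A *ᵥ x t ω + ε t ω
  orthonormal : Aᵀ * A = 1
  noise : ∃ μ S, IsWhiteNoise P ε μ S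
  white_comb : ∀ c : Fin r → ℝ,
    (∃ μ S, IsWhiteNoise P (fun t ω (_ : Fin 1) => c ⬝ᵥ x t ω) μ S) →
      ∀ k : ℤ, k ≠ 0 → ∀ t : ℤ, c ᵥ* covMat P (x (t + k)) (ε t) = 0

/-- The factors are weakly stationary and uncorrelated with present and future noise. -/
structure IsStationaryFactor {d r : ℕ} (P : Measure Ω) (x : ℤ → Ω → Fin r → ℝ)
    (ε : ℤ → Ω → Fin d → ℝ) : Prop where
  stationary : IsWeaklyStationary P x
  uncorrelated : ∀ (t : ℤ) (k : ℕ), covMat P (x t) (ε (t + k)) = 0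

/-- `λ_1 > ⋯ > λ_r > 0 = λ_{r+1} = ⋯ = λ_p`. -/
structure HasDistinctEig {d : ℕ} (P : Measure Ω) (k₀ r : ℕ) (y : ℤ → Ω → Fin d → ℝ) : Prop where
  strict : ∀ j, 1 ≤ j → j < r → popEig P k₀ y (j + 1) < popEig P k₀ y j
  pos : ∀ j, 1 ≤ j → j ≤ r → 0 < popEig P k₀ y j
  zero : ∀ j, r < j → j ≤ d → popEig P k₀ y j = 0

end TimeSeries

/-! ### Triangular arrays: the `m`-th model has dimension `p m` and lives on `Ω m` -/

section Arrays

variable {Ω : ℕ → Type*} [∀ m, MeasurableSpace (Ω m)]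

/-- Strict stationarity and `ψ`-mixing with `∑_{t ≥ 1} t ψ(t)^{1/2} < ∞`, and finite fourth moments
of all entries, with bounds that do not depend on the index of the array (hence not on `p`). -/
structure IsMixingArray {p : ℕ → ℕ} (P : ∀ m, Measure (Ω m))
    (y : ∀ m, ℤ → Ω m → Fin (p m) → ℝ) : Prop where
  stationary : ∀ m, IsStrictlyStationary (P m) (y m)
  mixing : ∃ K : ℝ≥0, ∀ m,
    ∑' t : ℕ, ((t + 1 : ℕ) : ℝ≥0∞) * psiMix (P m) (y m) (t + 1) ^ (1 / 2 : ℝ) ≤ K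
  moment : ∃ K : ℝ≥0, ∀ m t i, ∫⁻ ω, ‖y m t ω i‖ₑ ^ 4 ∂(P m) ≤ K

/-- Factor strength: `Σ_x(k)` is nonsingular, and `‖Σ_x(k)‖ ≍ p^{1-δ} ≍ ‖Σ_x(k)‖_min`, for
`k = 1, ..., k₀`. -/
structure HasStrength {r : ℕ} (P : ∀ m, Measure (Ω m)) (p : ℕ → ℕ) (k₀ : ℕ) (δ : ℝ)
    (x : ∀ m, ℤ → Ω m → Fin r → ℝ) : Prop where
  nonsingular : ∀ k ∈ Finset.Icc 1 k₀, ∀ m, (lagCov (P m) (x m) k).det ≠ 0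
  norm : ∀ k ∈ Finset.Icc 1 k₀,
    (fun m => specNorm (lagCov (P m) (x m) k)) =Θ[atTop] (fun m => (p m : ℝ) ^ (1 - δ))
  minNorm : ∀ k ∈ Finset.Icc 1 k₀,
    (fun m => minNorm (lagCov (P m) (x m) k)) =Θ[atTop] (fun m => (p m : ℝ) ^ (1 - δ))

/-- `‖Σ_{xε}(k)‖ = o(p^{1-δ})`, `Σ_{xε}(k) = cov(x_{t+k}, ε_t)`, for `k = 0, ..., k₀`. -/
def HasWeakCross {r : ℕ} {p : ℕ → ℕ} (P : ∀ m, Measure (Ω m)) (k₀ : ℕ) (δ : ℝ)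
    (x : ∀ m, ℤ → Ω m → Fin r → ℝ) (ε : ∀ m, ℤ → Ω m → Fin (p m) → ℝ) : Prop :=
  ∀ k ∈ Finset.Icc 0 k₀,
    (fun m => specNorm (covMat (P m) (x m k) (ε m 0))) =o[atTop] (fun m => (p m : ℝ) ^ (1 - δ))

/-- The event `E m` has probability tending to one (stated through complements, so that it is the
usual notion for measurable events, and is meaningful without checking measurability). -/
def WithProbTendingToOne (P : ∀ m, Measure (Ω m)) (E : ∀ m, Set (Ω m)) : Prop :=
  Tendsto (fun m => P m (E m)ᶜ) atTop (𝓝 0)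

/-- `X_m = O_P(a_m)`. -/
def IsBigOP (P : ∀ m, Measure (Ω m)) (X : ∀ m, Ω m → ℝ) (a : ℕ → ℝ) : Prop :=
  ∀ η : ℝ≥0∞, 0 < η → ∃ C : ℝ, ∀ᶠ m in atTop, P m {ω | C * |a m| < |X m ω|} ≤ η

/-- `X_m → 0` in probability. -/
def TendstoZeroInProb (P : ∀ m, Measure (Ω m)) (X : ∀ m, Ω m → ℝ) : Prop :=
  ∀ η : ℝ, 0 < η → Tendsto (fun m => P m {ω | η ≤ |X m ω|}) atTop (𝓝 0)

/-- `X_m ≍ 1` in probability: for suitable constants `0 < c ≤ C`, the inequalities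
`c ≤ X_m ≤ C` hold with probability tending to one. -/
def IsOrderOne (P : ∀ m, Measure (Ω m)) (X : ∀ m, Ω m → ℝ) : Prop :=
  ∃ c C : ℝ, 0 < c ∧ c ≤ C ∧ WithProbTendingToOne P (fun m => {ω | c ≤ X m ω ∧ X m ω ≤ C})

end Arrays

end FactorTS

end

/-!
The observations satisfy `y_t = A x_t + ε_t`, where at positive lags the noise is uncorrelated with
itself and with earlier factors. Hence `Σ_y(k) = A (Σ_x(k) Aᵀ + Σ_{xε}(k))` for `k ≥ 1`
(`lagCov_factorModel`): every `Σ_y(k)` has its range in the `r`-dimensional range of `A`, all its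
singular values are `O(p^{1-δ})`, and `Σ_y(1)ᵀ` is bounded below by a multiple of `p^{1-δ}` on the
range of `A`.

The quadratic form of `M̂` at `v` is `∑_k |Σ̂_y(k)ᵀ v|²`. Let `D` bound the Frobenius norms of
`Σ̂_y(k) - Σ_y(k)`. The min–max characterization of eigenvalues, tested on the range of `A` and on
its orthogonal complement, then gives constants with `λ̂_r ≥ (c p^{1-δ} - D)²`,
`λ̂_1 ≤ k₀ (b p^{1-δ} + D)²` and `λ̂_{r+1} ≤ k₀ D²` (`eventually_estEig_bounds`). The last bound is
quadratic in `D` because on the kernel of `Aᵀ` the population matrices vanish. The argument works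
with the range of `A` instead of the eigenvectors of `M`, so no gap between the population
eigenvalues enters.

It remains to see that `D = O_P(p / √n)`, with constants uniform in the model
(`measure_frobNorm_gt_le`): as `p / √n = (p^δ / √n) p^{1-δ}`, the deviation is then negligible
against `p^{1-δ}`, and `λ̂_{r+1} / λ̂_r` is of the order `(p^δ / √n)² = p^{2δ} / n`. Each entry of
`Σ̂_y(k) - Σ_y(k)` is a centred average of products of observations, up to products of two centred
averages and a term `O(1 / n)`. For the averages, the covariance inequality
`|cov(X, Y)| ≤ ψ(l) E|X| E|Y|` of `ψ`-mixing (`abs_cov_le_psiMix`) makes the variance `O(1 / n)`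
(`variance_sum_le`). The products of averages need no higher moments: the Frobenius norm of
`w uᵀ` is `|w| |u| ≤ |w|² + |u|²`, whose expectation is `O(p / n)`.
-/

namespace FactorTS

/-! ### Eigenvalues and quadratic forms -/

/-- Spectral theorem for a real symmetric matrix with the eigenvalues in decreasing order: an
orthonormal family `e` in which the quadratic form is diagonal, with the coefficient `eig hS (i + 1)`
at the `i`-th member (counted from `0`). -/
theorem exists_sorted_eigenbasis {p : ℕ} {S : Matrix (Fin p) (Fin p) ℝ} (hS : S.IsHermitian) :
    ∃ e : Fin p → Fin p → ℝ,
      (∀ i j, e i ⬝ᵥ e j = if i = j then 1 else 0) ∧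
      (∀ v, v ⬝ᵥ v = ∑ i, (e i ⬝ᵥ v) ^ 2) ∧
      (∀ v, v ⬝ᵥ S *ᵥ v = ∑ i : Fin p, eig hS (i + 1) * (e i ⬝ᵥ v) ^ 2) := by
  set τ : Fin p ≃ Fin p :=
    (finCongr (Fintype.card_fin p).symm).trans (Fintype.equivOfCardEq (Fintype.card_fin _))
  have hl : ∀ i : Fin p, eig hS (i + 1) = hS.eigenvalues (τ i) := by
    intro i
    have hi : 1 ≤ (i : ℕ) + 1 ∧ (i : ℕ) + 1 ≤ p := ⟨by omega, i.2⟩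
    simp only [eig, hi, Matrix.IsHermitian.eigenvalues]
    simp [τ]
    rfl
  have hin : ∀ i v, inner ℝ (hS.eigenvectorBasis i) (WithLp.toLp 2 v)
      = (hS.eigenvectorBasis i).ofLp ⬝ᵥ v := by
    intro i v
    simp [PiLp.inner_apply, dotProduct, mul_comm]
  refine ⟨fun i => (hS.eigenvectorBasis (τ i)).ofLp, ?_, ?_, ?_⟩
  · intro i j
    rw [← hin]
    have := hS.eigenvectorBasis.orthonormal
    rw [orthonormal_iff_ite] at this
    simpa using this (τ i) (τ j)
  · intro v
    have := hS.eigenvectorBasis.sum_sq_norm_inner_right (WithLp.toLp 2 v)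
    rw [EuclideanSpace.real_norm_sq_eq] at this
    rw [τ.sum_comp (fun i => ((hS.eigenvectorBasis i).ofLp ⬝ᵥ v) ^ 2)]
    simp only [hin, Real.norm_eq_abs, sq_abs] at this
    rw [this]
    simp [dotProduct, pow_two]
  · intro v
    simp only [hl]
    rw [τ.sum_comp (fun i => hS.eigenvalues i * ((hS.eigenvectorBasis i).ofLp ⬝ᵥ v) ^ 2)]
    have h1 := hS.eigenvectorBasis.sum_inner_mul_inner (WithLp.toLp 2 v)
      (WithLp.toLp 2 (S *ᵥ v))
    have h2 : inner ℝ (WithLp.toLp 2 v) (WithLp.toLp 2 (S *ᵥ v)) = v ⬝ᵥ S *ᵥ v := by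
      simp [PiLp.inner_apply, dotProduct, mul_comm]
    rw [← h2, ← h1]
    refine Finset.sum_congr rfl fun i _ => ?_
    have h3 : (hS.eigenvectorBasis i).ofLp ⬝ᵥ S *ᵥ v
        = hS.eigenvalues i * ((hS.eigenvectorBasis i).ofLp ⬝ᵥ v) := by
      have hT : Sᵀ = S := by
        have := hS.eq
        rwa [Matrix.conjTranspose_eq_transpose_of_trivial] at this
      rw [Matrix.dotProduct_mulVec, ← Matrix.mulVec_transpose, hT, hS.mulVec_eigenvectorBasis,
        smul_dotProduct, smul_eq_mul]
    rw [real_inner_comm, hin, hin, h3]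
    ring

theorem eig_antitone {p : ℕ} {S : Matrix (Fin p) (Fin p) ℝ} (hS : S.IsHermitian) {i j : ℕ}
    (hi : 1 ≤ i) (hij : i ≤ j) (hj : j ≤ p) : eig hS j ≤ eig hS i := by
  have h1 : 1 ≤ j ∧ j ≤ p := ⟨by omega, hj⟩
  have h2 : 1 ≤ i ∧ i ≤ p := ⟨hi, by omega⟩
  simp only [eig, h1, h2]
  apply hS.eigenvalues₀_antitone
  simp only [Fin.mk_le_mk]
  omega

/-- Max–min bound: a lower bound `c` for the quadratic form on the `r`-dimensional range of an
injective matrix is a lower bound for the `r`-th largest eigenvalue. -/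
theorem le_eig_of_form_ge {p r : ℕ} {S : Matrix (Fin p) (Fin p) ℝ} (hS : S.IsHermitian)
    (hr : 1 ≤ r) (hrp : r ≤ p) (A : Matrix (Fin p) (Fin r) ℝ) (hA : Aᵀ * A = 1) (c : ℝ)
    (h : ∀ u, c * (A *ᵥ u ⬝ᵥ A *ᵥ u) ≤ A *ᵥ u ⬝ᵥ S *ᵥ (A *ᵥ u)) : c ≤ eig hS r := by
  obtain ⟨e, -, hn, hq⟩ := exists_sorted_eigenbasis hS
  -- By dimension, some nonzero `A u` is orthogonal to the first `r - 1` eigenvectors.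
  let f : (Fin r → ℝ) →ₗ[ℝ] (Fin (r - 1) → ℝ) :=
    (Matrix.of fun i : Fin (r - 1) => e ⟨i, by omega⟩).mulVecLin ∘ₗ A.mulVecLin
  have hf : LinearMap.ker f ≠ ⊥ := LinearMap.ker_ne_bot_of_finrank_lt (by simp; omega)
  obtain ⟨u, hu, hu0⟩ := (Submodule.ne_bot_iff _).1 hf
  have hz : ∀ i : Fin p, (i : ℕ) < r - 1 → e i ⬝ᵥ A *ᵥ u = 0 := fun i hi =>
    congrFun (LinearMap.mem_ker.1 hu) ⟨i, hi⟩
  have hpos : 0 < A *ᵥ u ⬝ᵥ A *ᵥ u := by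
    refine lt_of_le_of_ne (by simpa using dotProduct_star_self_nonneg (A *ᵥ u)) fun h0 => hu0 ?_
    have h1 := dotProduct_self_eq_zero.1 h0.symm
    have : (Aᵀ * A) *ᵥ u = 0 := by rw [← Matrix.mulVec_mulVec, h1, Matrix.mulVec_zero]
    simpa [hA] using this
  refine le_of_mul_le_mul_right ((h u).trans ?_) hpos
  rw [hq, hn, Finset.mul_sum]
  refine Finset.sum_le_sum fun i _ => ?_
  by_cases hi : (i : ℕ) < r - 1
  · simp [hz i hi]
  · exact mul_le_mul_of_nonneg_right (eig_antitone hS hr (by omega) i.2) (sq_nonneg _)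

/-- Min–max bound: an upper bound `c` for the quadratic form on the kernel of `r` linear forms is
an upper bound for the `(r + 1)`-th largest eigenvalue. -/
theorem eig_succ_le_of_form_le {p r : ℕ} {S : Matrix (Fin p) (Fin p) ℝ} (hS : S.IsHermitian)
    (hrp : r + 1 ≤ p) (A : Matrix (Fin p) (Fin r) ℝ) (c : ℝ)
    (h : ∀ v, Aᵀ *ᵥ v = 0 → v ⬝ᵥ S *ᵥ v ≤ c * (v ⬝ᵥ v)) : eig hS (r + 1) ≤ c := by
  obtain ⟨e, ho, hn, hq⟩ := exists_sorted_eigenbasis hS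
  -- By dimension, a nonzero combination of the first `r + 1` eigenvectors is killed by `Aᵀ`.
  let E : Matrix (Fin (r + 1)) (Fin p) ℝ := Matrix.of fun i => e ⟨i, by omega⟩
  let f : (Fin (r + 1) → ℝ) →ₗ[ℝ] (Fin r → ℝ) := Aᵀ.mulVecLin ∘ₗ Eᵀ.mulVecLin
  have hf : LinearMap.ker f ≠ ⊥ := LinearMap.ker_ne_bot_of_finrank_lt (by simp)
  obtain ⟨w, hw, hw0⟩ := (Submodule.ne_bot_iff _).1 hf
  have hE : E * Eᵀ = 1 := by
    ext i j
    rw [Matrix.mul_apply_eq_vecMul, Matrix.one_apply]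
    change e _ ⬝ᵥ e _ = _
    rw [ho]
    simp [Fin.ext_iff]
  have hEv : ∀ i : Fin p, r < (i : ℕ) → e i ⬝ᵥ Eᵀ *ᵥ w = 0 := by
    intro i hi
    rw [Matrix.dotProduct_mulVec, Matrix.vecMul_transpose]
    have : E *ᵥ e i = 0 := by
      ext j
      change e _ ⬝ᵥ e _ = _
      rw [ho, if_neg]
      · rfl
      · intro h
        rw [Fin.ext_iff] at h
        simp at h
        omega
    rw [this, zero_dotProduct]
  have hpos : 0 < Eᵀ *ᵥ w ⬝ᵥ Eᵀ *ᵥ w := by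
    refine lt_of_le_of_ne (by simpa using dotProduct_star_self_nonneg (Eᵀ *ᵥ w)) fun h0 => hw0 ?_
    have h1 := dotProduct_self_eq_zero.1 h0.symm
    have : (E * Eᵀ) *ᵥ w = 0 := by rw [← Matrix.mulVec_mulVec, h1, Matrix.mulVec_zero]
    simpa [hE] using this
  refine le_of_mul_le_mul_right (le_trans ?_ (h _ (LinearMap.mem_ker.1 hw))) hpos
  rw [hq, hn, Finset.mul_sum]
  refine Finset.sum_le_sum fun i _ => ?_
  by_cases hi : r < (i : ℕ)
  · rw [Matrix.mulVecLin_apply, hEv i hi]; simp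
  · exact mul_le_mul_of_nonneg_right (eig_antitone hS (by omega) (by omega) hrp) (sq_nonneg _)

/-! ### Euclidean bounds for matrices acting on vectors -/

/-- The Euclidean norm on `Fin a → ℝ` (which carries the sup norm as a type). -/
noncomputable def euclNorm {a : ℕ} (v : Fin a → ℝ) : ℝ := ‖WithLp.toLp 2 v‖

theorem euclNorm_nonneg {a : ℕ} (v : Fin a → ℝ) : 0 ≤ euclNorm v := norm_nonneg _

theorem euclNorm_sq {a : ℕ} (v : Fin a → ℝ) : euclNorm v ^ 2 = v ⬝ᵥ v := by
  rw [euclNorm, EuclideanSpace.real_norm_sq_eq]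
  simp [dotProduct, pow_two]

theorem euclNorm_add_le {a : ℕ} (v w : Fin a → ℝ) : euclNorm (v + w) ≤ euclNorm v + euclNorm w :=
  norm_add_le (WithLp.toLp 2 v) (WithLp.toLp 2 w)

theorem euclNorm_neg {a : ℕ} (v : Fin a → ℝ) : euclNorm (-v) = euclNorm v :=
  norm_neg (WithLp.toLp 2 v)

theorem euclNorm_mulVec_of_orthonormal {a b : ℕ} {A : Matrix (Fin a) (Fin b) ℝ} (hA : Aᵀ * A = 1)
    (u : Fin b → ℝ) : euclNorm (A *ᵥ u) = euclNorm u := by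
  rw [← sq_eq_sq₀ (euclNorm_nonneg _) (euclNorm_nonneg _), euclNorm_sq, euclNorm_sq,
    Matrix.dotProduct_mulVec, ← Matrix.mulVec_transpose, Matrix.mulVec_mulVec, hA,
    Matrix.one_mulVec]

section
open scoped Matrix.Norms.L2Operator

theorem euclNorm_transpose_mulVec_le {a b : ℕ} (G : Matrix (Fin a) (Fin b) ℝ) (v : Fin a → ℝ) :
    euclNorm (Gᵀ *ᵥ v) ≤ specNorm G * euclNorm v := by
  have h := Matrix.l2_opNorm_mulVec Gᵀ (WithLp.toLp 2 v)
  rw [← Matrix.conjTranspose_eq_transpose_of_trivial, Matrix.l2_opNorm_conjTranspose] at h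
  rwa [Matrix.conjTranspose_eq_transpose_of_trivial] at h

theorem euclNorm_transpose_mulVec_le_of_orthonormal {a b : ℕ} {A : Matrix (Fin a) (Fin b) ℝ}
    (hA : Aᵀ * A = 1) (v : Fin a → ℝ) : euclNorm (Aᵀ *ᵥ v) ≤ euclNorm v := by
  have h : specNorm A ≤ 1 := by
    have h := Matrix.l2_opNorm_conjTranspose_mul_self A
    rw [Matrix.conjTranspose_eq_transpose_of_trivial, hA] at h
    have h1 : ‖(1 : Matrix (Fin b) (Fin b) ℝ)‖ ≤ 1 := by
      rw [Matrix.cstar_norm_def, map_one]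
      exact ContinuousLinearMap.norm_id_le
    unfold specNorm
    nlinarith [norm_nonneg A]
  calc _ ≤ specNorm A * euclNorm v := euclNorm_transpose_mulVec_le A v
    _ ≤ 1 * euclNorm v := mul_le_mul_of_nonneg_right h (euclNorm_nonneg _)
    _ = _ := one_mul _

theorem specNorm_nonneg {a b : ℕ} (G : Matrix (Fin a) (Fin b) ℝ) : 0 ≤ specNorm G := norm_nonneg G

end

/-- The Frobenius norm. -/
noncomputable def frobNorm {a b : ℕ} (G : Matrix (Fin a) (Fin b) ℝ) : ℝ := √(∑ i, ∑ j, G i j ^ 2)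

theorem frobNorm_nonneg {a b : ℕ} (G : Matrix (Fin a) (Fin b) ℝ) : 0 ≤ frobNorm G :=
  Real.sqrt_nonneg _

theorem frobNorm_sq {a b : ℕ} (G : Matrix (Fin a) (Fin b) ℝ) :
    frobNorm G ^ 2 = ∑ i, ∑ j, G i j ^ 2 :=
  Real.sq_sqrt (Finset.sum_nonneg fun _ _ => Finset.sum_nonneg fun _ _ => sq_nonneg _)

theorem euclNorm_transpose_mulVec_le_frobNorm {a b : ℕ} (G : Matrix (Fin a) (Fin b) ℝ)
    (v : Fin a → ℝ) : euclNorm (Gᵀ *ᵥ v) ≤ frobNorm G * euclNorm v := by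
  rw [← sq_le_sq₀ (euclNorm_nonneg _) (mul_nonneg (frobNorm_nonneg _) (euclNorm_nonneg _)),
    mul_pow, frobNorm_sq, euclNorm_sq, euclNorm_sq, Finset.sum_comm, Finset.sum_mul]
  refine Finset.sum_le_sum fun j _ => ?_
  have := Finset.sum_mul_sq_le_sq_mul_sq Finset.univ (fun i => G i j) v
  calc _ = (∑ i, G i j * v i) ^ 2 := by simp [Matrix.mulVec, dotProduct, pow_two]
    _ ≤ _ := this
    _ = _ := by simp [dotProduct, pow_two]

theorem minNorm_nonneg {a b : ℕ} (G : Matrix (Fin a) (Fin b) ℝ) : 0 ≤ minNorm G :=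
  Real.sqrt_nonneg _

/-- For nonsingular `G`, the number `minNorm G` is the smallest singular value. -/
theorem minNorm_mul_euclNorm_le {a : ℕ} (G : Matrix (Fin a) (Fin a) ℝ) (hG : G.det ≠ 0)
    (u : Fin a → ℝ) : minNorm G * euclNorm u ≤ euclNorm (Gᵀ *ᵥ u) := by
  have hS : (G * Gᵀ).IsHermitian := by
    simpa [Matrix.conjTranspose_eq_transpose_of_trivial] using
      Matrix.isHermitian_mul_conjTranspose_self G
  have hform : ∀ v, v ⬝ᵥ (G * Gᵀ) *ᵥ v = euclNorm (Gᵀ *ᵥ v) ^ 2 := by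
    intro v
    rw [euclNorm_sq, ← Matrix.mulVec_mulVec, Matrix.dotProduct_mulVec, ← Matrix.mulVec_transpose]
  have hdet : (G * Gᵀ).det ≠ 0 := by
    rw [Matrix.det_mul, Matrix.det_transpose]; exact mul_ne_zero hG hG
  have hnn : ∀ i, 0 ≤ hS.eigenvalues i := by
    have : (G * Gᵀ).PosSemidef := by
      simpa [Matrix.conjTranspose_eq_transpose_of_trivial] using
        Matrix.posSemidef_self_mul_conjTranspose G
    exact this.eigenvalues_nonneg
  have hbdd : BddBelow (spectrum ℝ (G * Gᵀ) \ {0}) :=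
    ((Matrix.finite_real_spectrum (A := G * Gᵀ)).subset Set.sdiff_subset).bddBelow
  have hle : ∀ i, sInf (spectrum ℝ (G * Gᵀ) \ {0}) ≤ hS.eigenvalues i := by
    intro i
    refine csInf_le hbdd ⟨hS.eigenvalues_mem_spectrum_real i, fun h0 => hdet ?_⟩
    rw [hS.det_eq_prod_eigenvalues]
    exact Finset.prod_eq_zero (Finset.mem_univ i) (by simpa using h0)
  have hs0 : 0 ≤ sInf (spectrum ℝ (G * Gᵀ) \ {0}) := by
    refine Real.sInf_nonneg fun x hx => ?_
    have := hx.1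
    rw [hS.spectrum_real_eq_range_eigenvalues] at this
    obtain ⟨i, rfl⟩ := this
    exact hnn i
  obtain ⟨e, -, hn, hq⟩ := exists_sorted_eigenbasis hS
  have hle' : ∀ i : Fin a, sInf (spectrum ℝ (G * Gᵀ) \ {0}) ≤ eig hS (i + 1) := by
    intro i
    have hi : 1 ≤ (i : ℕ) + 1 ∧ (i : ℕ) + 1 ≤ a := ⟨by omega, i.2⟩
    have := hle (Fintype.equivOfCardEq (Fintype.card_fin _)
      (⟨i, by rw [Fintype.card_fin]; exact i.2⟩ : Fin (Fintype.card (Fin a))))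
    simpa [Matrix.IsHermitian.eigenvalues, eig, hi] using this
  have hm := minNorm_nonneg G
  rw [← sq_le_sq₀ (mul_nonneg hm (euclNorm_nonneg _)) (euclNorm_nonneg _),
    mul_pow, minNorm, Real.sq_sqrt hs0, euclNorm_sq, ← hform, hq, hn, Finset.mul_sum]
  exact Finset.sum_le_sum fun i _ => mul_le_mul_of_nonneg_right (hle' i) (sq_nonneg _)

/-! ### Perturbation of `∑ S(k) S(k)ᵀ` -/

theorem dotProduct_sumSq_mulVec {p : ℕ} (k₀ : ℕ) (S : ℕ → Matrix (Fin p) (Fin p) ℝ)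
    (v : Fin p → ℝ) :
    v ⬝ᵥ sumSq k₀ S *ᵥ v = ∑ k ∈ Finset.Icc 1 k₀, euclNorm ((S k)ᵀ *ᵥ v) ^ 2 := by
  rw [sumSq, Matrix.sum_mulVec, dotProduct_sum]
  refine Finset.sum_congr rfl fun k _ => ?_
  rw [euclNorm_sq, ← Matrix.mulVec_mulVec, Matrix.dotProduct_mulVec, ← Matrix.mulVec_transpose]

theorem eig_one_sumSq_le {p k₀ : ℕ} (hp : 1 ≤ p) (S T : ℕ → Matrix (Fin p) (Fin p) ℝ)
    (b D : ℝ) (hb : ∀ k ∈ Finset.Icc 1 k₀, ∀ v, euclNorm ((S k)ᵀ *ᵥ v) ≤ b * euclNorm v)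
    (hD : ∀ k ∈ Finset.Icc 1 k₀, frobNorm (T k - S k) ≤ D) :
    eig (sumSq_isHermitian k₀ T) 1 ≤ k₀ * (b + D) ^ 2 := by
  refine eig_succ_le_of_form_le (r := 0) _ hp 0 _ fun v _ => ?_
  rw [dotProduct_sumSq_mulVec, ← euclNorm_sq]
  have : ∀ k ∈ Finset.Icc 1 k₀,
      euclNorm ((T k)ᵀ *ᵥ v) ^ 2 ≤ (b + D) ^ 2 * euclNorm v ^ 2 := by
    intro k hk
    rw [← mul_pow]
    refine pow_le_pow_left₀ (euclNorm_nonneg _) ?_ 2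
    have h1 : (T k)ᵀ *ᵥ v = (S k)ᵀ *ᵥ v + (T k - S k)ᵀ *ᵥ v := by
      rw [← Matrix.add_mulVec, ← Matrix.transpose_add, add_sub_cancel]
    rw [h1, add_mul]
    exact (euclNorm_add_le _ _).trans (add_le_add (hb k hk v)
      ((euclNorm_transpose_mulVec_le_frobNorm _ _).trans
        (mul_le_mul_of_nonneg_right (hD k hk) (euclNorm_nonneg _))))
  refine (Finset.sum_le_sum this).trans ?_
  simp [mul_assoc]

/-- The `r`-th eigenvalue is bounded below through a single summand, restricted to the range of the
loading matrix. -/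
theorem le_eig_sumSq {p r k₀ : ℕ} (hr : 1 ≤ r) (hrp : r ≤ p) (hk₀ : 1 ≤ k₀)
    {A : Matrix (Fin p) (Fin r) ℝ} (hA : Aᵀ * A = 1) (S T : ℕ → Matrix (Fin p) (Fin p) ℝ)
    (c D : ℝ) (hc : ∀ u, c * euclNorm u ≤ euclNorm ((S 1)ᵀ *ᵥ (A *ᵥ u)))
    (hD : frobNorm (T 1 - S 1) ≤ D) (hDc : D ≤ c) :
    (c - D) ^ 2 ≤ eig (sumSq_isHermitian k₀ T) r := by
  refine le_eig_of_form_ge _ hr hrp A hA _ fun u => ?_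
  rw [dotProduct_sumSq_mulVec, ← euclNorm_sq, ← mul_pow]
  refine le_trans ?_ (Finset.single_le_sum (f := fun k => euclNorm ((T k)ᵀ *ᵥ (A *ᵥ u)) ^ 2)
    (fun k _ => sq_nonneg _) (Finset.mem_Icc.2 ⟨le_rfl, hk₀⟩))
  refine pow_le_pow_left₀ (mul_nonneg (sub_nonneg.2 hDc) (euclNorm_nonneg _)) ?_ 2
  have h1 : (S 1)ᵀ *ᵥ (A *ᵥ u) = (T 1)ᵀ *ᵥ (A *ᵥ u) + -((T 1 - S 1)ᵀ *ᵥ (A *ᵥ u)) := by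
    rw [← Matrix.neg_mulVec, ← Matrix.add_mulVec, ← Matrix.transpose_neg, ← Matrix.transpose_add,
      neg_sub, add_sub_cancel]
  have h2 := euclNorm_add_le ((T 1)ᵀ *ᵥ (A *ᵥ u)) (-((T 1 - S 1)ᵀ *ᵥ (A *ᵥ u)))
  rw [← h1, euclNorm_neg] at h2
  have h3 := euclNorm_transpose_mulVec_le_frobNorm (T 1 - S 1) (A *ᵥ u)
  have h4 := mul_le_mul_of_nonneg_right hD (euclNorm_nonneg (A *ᵥ u))
  have h5 := hc u
  rw [euclNorm_mulVec_of_orthonormal hA] at h3 h4 ⊢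
  linarith

/-- On the kernel of `Aᵀ` only the perturbation acts, so the `(r + 1)`-th eigenvalue is of second
order in the perturbation. -/
theorem eig_succ_sumSq_le {p r k₀ : ℕ} (hrp : r + 1 ≤ p) (A : Matrix (Fin p) (Fin r) ℝ)
    (S T : ℕ → Matrix (Fin p) (Fin p) ℝ) (D : ℝ)
    (hS : ∀ k ∈ Finset.Icc 1 k₀, ∀ v, Aᵀ *ᵥ v = 0 → (S k)ᵀ *ᵥ v = 0)
    (hD : ∀ k ∈ Finset.Icc 1 k₀, frobNorm (T k - S k) ≤ D) :
    eig (sumSq_isHermitian k₀ T) (r + 1) ≤ k₀ * D ^ 2 := by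
  refine eig_succ_le_of_form_le _ hrp A _ fun v hv => ?_
  rw [dotProduct_sumSq_mulVec, ← euclNorm_sq]
  have : ∀ k ∈ Finset.Icc 1 k₀, euclNorm ((T k)ᵀ *ᵥ v) ^ 2 ≤ D ^ 2 * euclNorm v ^ 2 := by
    intro k hk
    rw [← mul_pow]
    refine pow_le_pow_left₀ (euclNorm_nonneg _) ?_ 2
    have h1 : (T k)ᵀ *ᵥ v = (T k - S k)ᵀ *ᵥ v := by
      rw [Matrix.transpose_sub, Matrix.sub_mulVec, hS k hk v hv, sub_zero]
    rw [h1]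
    exact (euclNorm_transpose_mulVec_le_frobNorm _ _).trans
        (mul_le_mul_of_nonneg_right (hD k hk) (euclNorm_nonneg _))
  refine (Finset.sum_le_sum this).trans ?_
  simp [mul_assoc]

theorem eig_sumSq_nonneg {p : ℕ} (k₀ : ℕ) (T : ℕ → Matrix (Fin p) (Fin p) ℝ) (j : ℕ) :
    0 ≤ eig (sumSq_isHermitian k₀ T) j := by
  by_cases hj : 1 ≤ j ∧ j ≤ p
  · obtain ⟨e, ho, -, hq⟩ := exists_sorted_eigenbasis (sumSq_isHermitian k₀ T)
    have h := hq (e ⟨j - 1, by omega⟩)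
    simp only [ho, dotProduct_sumSq_mulVec] at h
    rw [Finset.sum_eq_single (⟨j - 1, by omega⟩ : Fin p) (fun b _ hb => by simp [hb])
      (by simp)] at h
    have h0 := Finset.sum_nonneg (s := Finset.Icc 1 k₀)
      fun k _ => sq_nonneg (euclNorm ((T k)ᵀ *ᵥ e ⟨j - 1, by omega⟩))
    rw [h] at h0
    simpa [Nat.sub_add_cancel hj.1] using h0
  · simp [eig, hj]

/-! ### The covariance inequality for `ψ`-mixing -/

section Mixing

variable {Ω : Type*}

/-- An upper bound `μ (A ∩ B) ≤ c * μ A * μ B` over two sub-σ-algebras extends from sets to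
nonnegative functions. For fixed `B` both sides are measures in `A`, which extends the bound to
`f`; for fixed `f` they are then measures in `B`. -/
theorem lintegral_mul_le_of_inter_le {m₁ m₂ m₀ : MeasurableSpace Ω} (h₁ : m₁ ≤ m₀) (h₂ : m₂ ≤ m₀)
    (μ : Measure Ω) [IsProbabilityMeasure μ] (c : ℝ≥0∞)
    (h : ∀ A B, MeasurableSet[m₁] A → MeasurableSet[m₂] B → μ (A ∩ B) ≤ c * (μ A * μ B))
    {f g : Ω → ℝ≥0∞} (hf : Measurable[m₁] f) (hg : Measurable[m₂] g) :
    ∫⁻ ω, f ω * g ω ∂μ ≤ c * ((∫⁻ ω, f ω ∂μ) * ∫⁻ ω, g ω ∂μ) := by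
  have hf0 := hf.mono h₁ le_rfl
  have hg0 := hg.mono h₂ le_rfl
  have step : ∀ B, MeasurableSet[m₂] B → ∫⁻ ω in B, f ω ∂μ ≤ (c * μ B) * ∫⁻ ω, f ω ∂μ := by
    intro B hB
    have hle : (μ.restrict B).trim h₁ ≤ (c * μ B) • μ.trim h₁ := by
      refine Measure.le_iff.2 fun A hA => ?_
      rw [Measure.smul_apply, trim_measurableSet_eq h₁ hA, trim_measurableSet_eq h₁ hA,
        Measure.restrict_apply (h₁ _ hA), smul_eq_mul]
      exact (h A B hA hB).trans_eq (by ring)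
    have := lintegral_mono' hle (le_refl f)
    rwa [lintegral_smul_measure, lintegral_trim h₁ hf, lintegral_trim h₁ hf, smul_eq_mul] at this
  have hle : (μ.withDensity f).trim h₂ ≤ (c * ∫⁻ ω, f ω ∂μ) • μ.trim h₂ := by
    refine Measure.le_iff.2 fun B hB => ?_
    rw [Measure.smul_apply, trim_measurableSet_eq h₂ hB, trim_measurableSet_eq h₂ hB,
      withDensity_apply _ (h₂ _ hB), smul_eq_mul]
    exact (step B hB).trans_eq (by ring)
  have := lintegral_mono' hle (le_refl g)
  rw [lintegral_smul_measure, lintegral_trim h₂ hg, lintegral_trim h₂ hg, smul_eq_mul,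
    lintegral_withDensity_eq_lintegral_mul _ hf0 hg0, mul_assoc] at this
  exact this

/-- The lower bound that corresponds to `lintegral_mul_le_of_inter_le`, with the subtraction moved
to the other side. -/
theorem le_lintegral_mul_of_le_inter {m₁ m₂ m₀ : MeasurableSpace Ω} (h₁ : m₁ ≤ m₀) (h₂ : m₂ ≤ m₀)
    (μ : Measure Ω) [IsProbabilityMeasure μ] (c : ℝ≥0∞)
    (h : ∀ A B, MeasurableSet[m₁] A → MeasurableSet[m₂] B →
      μ A * μ B ≤ μ (A ∩ B) + c * (μ A * μ B))
    {f g : Ω → ℝ≥0∞} (hf : Measurable[m₁] f) (hg : Measurable[m₂] g) :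
    (∫⁻ ω, f ω ∂μ) * ∫⁻ ω, g ω ∂μ ≤
      ∫⁻ ω, f ω * g ω ∂μ + c * ((∫⁻ ω, f ω ∂μ) * ∫⁻ ω, g ω ∂μ) := by
  have hf0 := hf.mono h₁ le_rfl
  have hg0 := hg.mono h₂ le_rfl
  have step : ∀ B, MeasurableSet[m₂] B →
      μ B * ∫⁻ ω, f ω ∂μ ≤ ∫⁻ ω in B, f ω ∂μ + (c * μ B) * ∫⁻ ω, f ω ∂μ := by
    intro B hB
    have hle : μ B • μ.trim h₁ ≤ (μ.restrict B).trim h₁ + (c * μ B) • μ.trim h₁ := by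
      refine Measure.le_iff.2 fun A hA => ?_
      rw [Measure.add_apply, Measure.smul_apply, Measure.smul_apply, trim_measurableSet_eq h₁ hA,
        trim_measurableSet_eq h₁ hA, Measure.restrict_apply (h₁ _ hA), smul_eq_mul, smul_eq_mul]
      calc μ B * μ A = μ A * μ B := mul_comm _ _
        _ ≤ _ := h A B hA hB
        _ = _ := by ring
    have := lintegral_mono' hle (le_refl f)
    rwa [lintegral_add_measure, lintegral_smul_measure, lintegral_smul_measure,
      lintegral_trim h₁ hf, lintegral_trim h₁ hf, smul_eq_mul, smul_eq_mul] at this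
  have hle : (∫⁻ ω, f ω ∂μ) • μ.trim h₂ ≤
      (μ.withDensity f).trim h₂ + (c * ∫⁻ ω, f ω ∂μ) • μ.trim h₂ := by
    refine Measure.le_iff.2 fun B hB => ?_
    rw [Measure.add_apply, Measure.smul_apply, Measure.smul_apply, trim_measurableSet_eq h₂ hB,
      trim_measurableSet_eq h₂ hB, withDensity_apply _ (h₂ _ hB), smul_eq_mul, smul_eq_mul]
    calc _ = μ B * ∫⁻ ω, f ω ∂μ := mul_comm _ _
      _ ≤ _ := step B hB
      _ = _ := by ring
  have := lintegral_mono' hle (le_refl g)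
  rw [lintegral_add_measure, lintegral_smul_measure, lintegral_smul_measure,
    lintegral_trim h₂ hg, lintegral_trim h₂ hg, smul_eq_mul, smul_eq_mul,
    lintegral_withDensity_eq_lintegral_mul _ hf0 hg0, mul_assoc] at this
  exact this

/-- Relative closeness of `μ (A ∩ B)` to `μ A * μ B` on two sub-σ-algebras bounds covariances of
nonnegative functions. -/
theorem abs_integral_mul_sub_le_of_nonneg {m₁ m₂ m₀ : MeasurableSpace Ω} (h₁ : m₁ ≤ m₀)
    (h₂ : m₂ ≤ m₀) (μ : Measure Ω) [IsProbabilityMeasure μ] (c : ℝ≥0)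
    (hu : ∀ A B, MeasurableSet[m₁] A → MeasurableSet[m₂] B → μ (A ∩ B) ≤ (1 + c) * (μ A * μ B))
    (hl : ∀ A B, MeasurableSet[m₁] A → MeasurableSet[m₂] B →
      μ A * μ B ≤ μ (A ∩ B) + c * (μ A * μ B))
    {X Y : Ω → ℝ} (hX : Measurable[m₁] X) (hY : Measurable[m₂] Y) (hX0 : 0 ≤ X) (hY0 : 0 ≤ Y)
    (hXi : Integrable X μ) (hYi : Integrable Y μ) (hXY : Integrable (fun ω => X ω * Y ω) μ) :
    |∫ ω, X ω * Y ω ∂μ - (∫ ω, X ω ∂μ) * ∫ ω, Y ω ∂μ| ≤ c * ((∫ ω, X ω ∂μ) * ∫ ω, Y ω ∂μ) := by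
  have eX : ∫⁻ ω, ENNReal.ofReal (X ω) ∂μ = ENNReal.ofReal (∫ ω, X ω ∂μ) :=
    (ofReal_integral_eq_lintegral_ofReal hXi (Eventually.of_forall hX0)).symm
  have eY : ∫⁻ ω, ENNReal.ofReal (Y ω) ∂μ = ENNReal.ofReal (∫ ω, Y ω ∂μ) :=
    (ofReal_integral_eq_lintegral_ofReal hYi (Eventually.of_forall hY0)).symm
  have eXY : ∫⁻ ω, ENNReal.ofReal (X ω) * ENNReal.ofReal (Y ω) ∂μ =
      ENNReal.ofReal (∫ ω, X ω * Y ω ∂μ) := by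
    rw [ofReal_integral_eq_lintegral_ofReal hXY
      (Eventually.of_forall fun ω => mul_nonneg (hX0 ω) (hY0 ω))]
    exact lintegral_congr fun ω => (ENNReal.ofReal_mul (hX0 ω)).symm
  have x0 : 0 ≤ ∫ ω, X ω ∂μ := integral_nonneg hX0
  have y0 : 0 ≤ ∫ ω, Y ω ∂μ := integral_nonneg hY0
  have xy0 : 0 ≤ ∫ ω, X ω * Y ω ∂μ := integral_nonneg fun ω => mul_nonneg (hX0 ω) (hY0 ω)
  have hc : (c : ℝ≥0∞) = ENNReal.ofReal c := (ENNReal.ofReal_coe_nnreal).symm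
  have c0 : (0 : ℝ) ≤ c := c.2
  have mX : Measurable[m₁] fun ω => ENNReal.ofReal (X ω) := ENNReal.measurable_ofReal.comp hX
  have mY : Measurable[m₂] fun ω => ENNReal.ofReal (Y ω) := ENNReal.measurable_ofReal.comp hY
  have U := lintegral_mul_le_of_inter_le h₁ h₂ μ _ hu mX mY
  have L := le_lintegral_mul_of_le_inter h₁ h₂ μ _ hl mX mY
  rw [eX, eY, eXY, hc, ← ENNReal.ofReal_one, ← ENNReal.ofReal_add zero_le_one c0,
    ← ENNReal.ofReal_mul x0, ← ENNReal.ofReal_mul (by positivity),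
    ENNReal.ofReal_le_ofReal_iff (by positivity)] at U
  rw [eX, eY, eXY, hc, ← ENNReal.ofReal_mul x0, ← ENNReal.ofReal_mul c0,
    ← ENNReal.ofReal_add xy0 (by positivity), ENNReal.ofReal_le_ofReal_iff (by positivity)] at L
  rw [abs_le]
  constructor <;> linarith

/-- Relative closeness of `μ (A ∩ B)` to `μ A * μ B` on two sub-σ-algebras bounds covariances. -/
theorem abs_integral_mul_sub_le {m₁ m₂ m₀ : MeasurableSpace Ω} (h₁ : m₁ ≤ m₀)
    (h₂ : m₂ ≤ m₀) (μ : Measure Ω) [IsProbabilityMeasure μ] (c : ℝ≥0)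
    (hu : ∀ A B, MeasurableSet[m₁] A → MeasurableSet[m₂] B → μ (A ∩ B) ≤ (1 + c) * (μ A * μ B))
    (hl : ∀ A B, MeasurableSet[m₁] A → MeasurableSet[m₂] B →
      μ A * μ B ≤ μ (A ∩ B) + c * (μ A * μ B))
    {X Y : Ω → ℝ} (hX : Measurable[m₁] X) (hY : Measurable[m₂] Y)
    (hX2 : MemLp X 2 μ) (hY2 : MemLp Y 2 μ) :
    |∫ ω, X ω * Y ω ∂μ - (∫ ω, X ω ∂μ) * ∫ ω, Y ω ∂μ| ≤
      c * ((∫ ω, |X ω| ∂μ) * ∫ ω, |Y ω| ∂μ) := by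
  have memPos : ∀ Z : Ω → ℝ, MemLp Z 2 μ → MemLp (fun ω => max (Z ω) 0) 2 μ := fun Z hZ =>
    hZ.sup (MemLp.zero : MemLp (0 : Ω → ℝ) 2 μ)
  have hXn2 : MemLp (fun ω => -X ω) 2 μ := hX2.neg
  have hYn2 : MemLp (fun ω => -Y ω) 2 μ := hY2.neg
  have one2 : (1 : ℝ≥0∞) ≤ 2 := one_le_two
  -- The four products of positive and negative parts.
  have key : ∀ X' Y' : Ω → ℝ, Measurable[m₁] X' → Measurable[m₂] Y' → MemLp X' 2 μ →
      MemLp Y' 2 μ → |∫ ω, max (X' ω) 0 * max (Y' ω) 0 ∂μ -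
        (∫ ω, max (X' ω) 0 ∂μ) * ∫ ω, max (Y' ω) 0 ∂μ| ≤
        c * ((∫ ω, max (X' ω) 0 ∂μ) * ∫ ω, max (Y' ω) 0 ∂μ) := by
    intro X' Y' hX' hY' hX2' hY2'
    exact abs_integral_mul_sub_le_of_nonneg h₁ h₂ μ c hu hl (hX'.max measurable_const)
      (hY'.max measurable_const) (fun _ => le_max_right _ _) (fun _ => le_max_right _ _)
      ((memPos _ hX2').integrable one2) ((memPos _ hY2').integrable one2)
      ((memPos _ hX2').integrable_mul (memPos _ hY2'))
  have k1 := key X Y hX hY hX2 hY2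
  have k2 := key X (fun ω => -Y ω) hX hY.neg hX2 hYn2
  have k3 := key (fun ω => -X ω) Y hX.neg hY hXn2 hY2
  have k4 := key (fun ω => -X ω) (fun ω => -Y ω) hX.neg hY.neg hXn2 hYn2
  have decomp : ∀ a : ℝ, a = max a 0 - max (-a) 0 := fun a => by
    rcases le_total a 0 with h | h <;> simp [h]
  have adecomp : ∀ a : ℝ, |a| = max a 0 + max (-a) 0 := fun a => by
    rcases le_total a 0 with h | h <;> simp [h, abs_of_nonneg, abs_of_nonpos]
  have i : ∀ Z : Ω → ℝ, MemLp Z 2 μ → Integrable (fun ω => max (Z ω) 0) μ := fun Z hZ =>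
    (memPos Z hZ).integrable one2
  have ii : ∀ Z W : Ω → ℝ, MemLp Z 2 μ → MemLp W 2 μ →
      Integrable (fun ω => max (Z ω) 0 * max (W ω) 0) μ := fun Z W hZ hW =>
    (memPos Z hZ).integrable_mul (memPos W hW)
  have eX : ∫ ω, X ω ∂μ = ∫ ω, max (X ω) 0 ∂μ - ∫ ω, max (-X ω) 0 ∂μ := by
    rw [← integral_sub (i _ hX2) (i _ hXn2)]
    exact integral_congr_ae (Eventually.of_forall fun ω => decomp _)
  have eY : ∫ ω, Y ω ∂μ = ∫ ω, max (Y ω) 0 ∂μ - ∫ ω, max (-Y ω) 0 ∂μ := by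
    rw [← integral_sub (i _ hY2) (i _ hYn2)]
    exact integral_congr_ae (Eventually.of_forall fun ω => decomp _)
  have aX : ∫ ω, |X ω| ∂μ = ∫ ω, max (X ω) 0 ∂μ + ∫ ω, max (-X ω) 0 ∂μ := by
    rw [← integral_add (i _ hX2) (i _ hXn2)]
    exact integral_congr_ae (Eventually.of_forall fun ω => adecomp _)
  have aY : ∫ ω, |Y ω| ∂μ = ∫ ω, max (Y ω) 0 ∂μ + ∫ ω, max (-Y ω) 0 ∂μ := by
    rw [← integral_add (i _ hY2) (i _ hYn2)]
    exact integral_congr_ae (Eventually.of_forall fun ω => adecomp _)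
  have eXY : ∫ ω, X ω * Y ω ∂μ =
      (∫ ω, max (X ω) 0 * max (Y ω) 0 ∂μ - ∫ ω, max (X ω) 0 * max (-Y ω) 0 ∂μ) -
      (∫ ω, max (-X ω) 0 * max (Y ω) 0 ∂μ - ∫ ω, max (-X ω) 0 * max (-Y ω) 0 ∂μ) := by
    rw [← integral_sub (ii _ _ hX2 hY2) (ii _ _ hX2 hYn2),
      ← integral_sub (ii _ _ hXn2 hY2) (ii _ _ hXn2 hYn2)]
    refine Eq.trans ?_ (integral_sub ((ii _ _ hX2 hY2).sub (ii _ _ hX2 hYn2))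
        ((ii _ _ hXn2 hY2).sub (ii _ _ hXn2 hYn2)))
    refine integral_congr_ae (Eventually.of_forall fun ω => ?_)
    change X ω * Y ω = _
    conv_lhs => rw [decomp (X ω), decomp (Y ω)]
    ring
  rw [eX, eY, eXY, aX, aY]
  rw [abs_le] at k1 k2 k3 k4 ⊢
  constructor <;> linarith [k1.1, k1.2, k2.1, k2.2, k3.1, k3.2, k4.1, k4.2]

theorem measurable_past {d : ℕ} (y : ℤ → Ω → Fin d → ℝ) {t : ℤ} (ht : t ≤ 0) :
    Measurable[past y] (y t) :=
  (comap_measurable (y t)).mono (le_iSup₂_of_le t ht le_rfl) le_rfl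

theorem measurable_future {d : ℕ} (y : ℤ → Ω → Fin d → ℝ) {k : ℕ} {t : ℤ} (ht : (k : ℤ) ≤ t) :
    Measurable[future y k] (y t) :=
  (comap_measurable (y t)).mono (le_iSup₂_of_le t ht le_rfl) le_rfl

variable [MeasurableSpace Ω]

theorem past_le {d : ℕ} {y : ℤ → Ω → Fin d → ℝ} (hy : ∀ t, Measurable (y t)) :
    past y ≤ (inferInstance : MeasurableSpace Ω) :=
  iSup₂_le fun t _ => (hy t).comap_le

theorem future_le {d : ℕ} {y : ℤ → Ω → Fin d → ℝ} (hy : ∀ t, Measurable (y t)) (k : ℕ) :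
    future y k ≤ (inferInstance : MeasurableSpace Ω) :=
  iSup₂_le fun t _ => (hy t).comap_le

theorem abs_measureReal_inter_sub_le {d : ℕ} (P : Measure Ω) [IsProbabilityMeasure P]
    (y : ℤ → Ω → Fin d → ℝ) {k : ℕ} (hk : psiMix P y k ≠ ∞) {A B : Set Ω}
    (hA : MeasurableSet[past y] A) (hB : MeasurableSet[future y k] B) :
    |P.real A * P.real B - P.real (A ∩ B)| ≤ (psiMix P y k).toReal * (P.real A * P.real B) := by
  by_cases h0 : P A = 0 ∨ P B = 0
  · have hAB : P.real (A ∩ B) = 0 := by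
      rcases h0 with h | h
      · simp [Measure.real, measure_mono_null Set.inter_subset_left h]
      · simp [Measure.real, measure_mono_null Set.inter_subset_right h]
    have : P.real A * P.real B = 0 := by
      rcases h0 with h | h <;> simp [Measure.real, h]
    simp [hAB, this]
  · push Not at h0
    have hpos : 0 < P.real A * P.real B :=
      mul_pos (ENNReal.toReal_pos h0.1 (measure_ne_top _ _))
        (ENNReal.toReal_pos h0.2 (measure_ne_top _ _))
    have hle : ENNReal.ofReal |1 - P.real (A ∩ B) / (P.real A * P.real B)| ≤ psiMix P y k :=
      le_iSup_of_le A <| le_iSup_of_le B <| le_iSup_of_le hA <| le_iSup_of_le hB <|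
        le_iSup_of_le h0.1 <| le_iSup_of_le h0.2 le_rfl
    rw [ENNReal.ofReal_le_iff_le_toReal hk] at hle
    calc |P.real A * P.real B - P.real (A ∩ B)|
        = |1 - P.real (A ∩ B) / (P.real A * P.real B)| * (P.real A * P.real B) := by
          rw [← abs_of_pos hpos, ← abs_mul, abs_of_pos hpos, sub_mul,
            div_mul_cancel₀ _ hpos.ne', one_mul]
      _ ≤ _ := mul_le_mul_of_nonneg_right hle hpos.le

/-- The covariance inequality for `ψ`-mixing:
`|cov(X, Y)| ≤ ψ(k) E|X| E|Y|` for `X` in the past and `Y` in the future from time `k`. -/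
theorem abs_cov_le_psiMix {d : ℕ} (P : Measure Ω) [IsProbabilityMeasure P]
    {y : ℤ → Ω → Fin d → ℝ} (hy : ∀ t, Measurable (y t)) {k : ℕ} (hk : psiMix P y k ≠ ∞)
    {X Y : Ω → ℝ} (hX : Measurable[past y] X) (hY : Measurable[future y k] Y)
    (hX2 : MemLp X 2 P) (hY2 : MemLp Y 2 P) :
    |cov[X, Y; P]| ≤ (psiMix P y k).toReal * ((∫ ω, |X ω| ∂P) * ∫ ω, |Y ω| ∂P) := by
  rw [covariance_eq_sub hX2 hY2]
  have conv : ∀ s : Set Ω, P s = ENNReal.ofReal (P.real s) := fun s =>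
    (ENNReal.ofReal_toReal (measure_ne_top _ _)).symm
  have hc : ((psiMix P y k).toNNReal : ℝ≥0∞) = ENNReal.ofReal (psiMix P y k).toReal :=
    (ENNReal.coe_toNNReal hk).trans (ENNReal.ofReal_toReal hk).symm
  refine abs_integral_mul_sub_le (past_le hy) (future_le hy k) P (psiMix P y k).toNNReal ?_ ?_
    hX hY hX2 hY2
  · intro A B hA hB
    have h := (abs_le.1 (abs_measureReal_inter_sub_le P y hk hA hB)).1
    rw [conv A, conv B, conv (A ∩ B), hc, ← ENNReal.ofReal_one,
      ← ENNReal.ofReal_add zero_le_one ENNReal.toReal_nonneg,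
      ← ENNReal.ofReal_mul measureReal_nonneg,
      ← ENNReal.ofReal_mul (add_nonneg zero_le_one ENNReal.toReal_nonneg)]
    exact ENNReal.ofReal_le_ofReal (by linarith)
  · intro A B hA hB
    have h := (abs_le.1 (abs_measureReal_inter_sub_le P y hk hA hB)).2
    rw [conv A, conv B, conv (A ∩ B), hc, ← ENNReal.ofReal_mul measureReal_nonneg,
      ← ENNReal.ofReal_mul ENNReal.toReal_nonneg,
      ← ENNReal.ofReal_add measureReal_nonneg
        (mul_nonneg ENNReal.toReal_nonneg (mul_nonneg measureReal_nonneg measureReal_nonneg))]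
    exact ENNReal.ofReal_le_ofReal (by linarith)

end Mixing

/-! ### Variance of sums along a stationary `ψ`-mixing process -/

section Variance

variable {Ω : Type*} [MeasurableSpace Ω]

theorem integral_comp_shift {d : ℕ} {P : Measure Ω} {y : ℤ → Ω → Fin d → ℝ}
    (hy : ∀ t, Measurable (y t)) (hstat : IsStrictlyStationary P y)
    {Φ : (ℤ → Fin d → ℝ) → ℝ} (hΦ : Measurable Φ) (h : ℤ) :
    ∫ ω, Φ (fun t => y (t + h) ω) ∂P = ∫ ω, Φ (fun t => y t ω) ∂P := by
  have m : ∀ h : ℤ, Measurable fun ω (t : ℤ) => y (t + h) ω := fun h =>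
    measurable_pi_lambda _ fun t => hy _
  have m0 : Measurable fun ω (t : ℤ) => y t ω := measurable_pi_lambda _ fun t => hy _
  rw [← integral_map (m h).aemeasurable hΦ.aestronglyMeasurable,
    ← integral_map m0.aemeasurable hΦ.aestronglyMeasurable, hstat h]

/-- Summability of the mixing coefficients, extracted from a bound on `∑ t ψ(t)^{1/2}`: each term
gives `ψ(t)^{1/2} ≤ K`, hence `ψ(t) ≤ K · t ψ(t)^{1/2}`. -/
theorem psiMix_bounds {d : ℕ} {P : Measure Ω} {y : ℤ → Ω → Fin d → ℝ} {K : ℝ≥0}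
    (hK : ∑' t : ℕ, ((t + 1 : ℕ) : ℝ≥0∞) * psiMix P y (t + 1) ^ (1 / 2 : ℝ) ≤ K) :
    (∀ t, psiMix P y (t + 1) ≠ ∞) ∧
      ∀ N, ∑ t ∈ Finset.range N, (psiMix P y (t + 1)).toReal ≤ (K : ℝ) ^ 2 := by
  have one : ∀ t : ℕ, psiMix P y (t + 1) ^ (1 / 2 : ℝ) ≤
      ((t + 1 : ℕ) : ℝ≥0∞) * psiMix P y (t + 1) ^ (1 / 2 : ℝ) := fun t =>
    le_mul_of_one_le_left zero_le (by exact_mod_cast Nat.succ_pos t)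
  have le1 : ∀ t, psiMix P y (t + 1) ^ (1 / 2 : ℝ) ≤ K := fun t =>
    ((one t).trans (ENNReal.le_tsum t)).trans hK
  have sq : ∀ t, psiMix P y (t + 1) =
      psiMix P y (t + 1) ^ (1 / 2 : ℝ) * psiMix P y (t + 1) ^ (1 / 2 : ℝ) := fun t => by
    rw [← ENNReal.rpow_add_of_nonneg _ _ (by norm_num) (by norm_num)]
    norm_num
  have fin : ∀ t, psiMix P y (t + 1) ≠ ∞ := fun t => by
    have h := ne_top_of_le_ne_top ENNReal.coe_ne_top (le1 t)
    rw [sq t]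
    exact ENNReal.mul_ne_top h h
  refine ⟨fin, fun N => ?_⟩
  have hsum : ∑ t ∈ Finset.range N, psiMix P y (t + 1) ≤ (K : ℝ≥0∞) * K := by
    calc ∑ t ∈ Finset.range N, psiMix P y (t + 1)
        ≤ ∑ t ∈ Finset.range N,
            (K : ℝ≥0∞) * (((t + 1 : ℕ) : ℝ≥0∞) * psiMix P y (t + 1) ^ (1 / 2 : ℝ)) := by
          refine Finset.sum_le_sum fun t _ => ?_
          rw [sq t]
          exact mul_le_mul' (le1 t) ((sq t) ▸ one t)
      _ ≤ _ := by
          rw [← Finset.mul_sum]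
          exact mul_le_mul' le_rfl ((ENNReal.sum_le_tsum _).trans hK)
  rw [← ENNReal.toReal_sum fun t _ => fin t]
  have := ENNReal.toReal_mono (ENNReal.mul_ne_top ENNReal.coe_ne_top ENNReal.coe_ne_top) hsum
  simpa [pow_two] using this

/-- A double sum of a function of the time lag over `{1, …, N}²` is at most `2 N` times a bound for
its partial sums. -/
theorem sum_sum_dist_le (g : ℕ → ℝ) (hg : ∀ l, 0 ≤ g l) (G : ℝ)
    (hG : ∀ N, ∑ l ∈ Finset.range N, g l ≤ G) (N : ℕ) :
    ∑ s ∈ Finset.Icc 1 N, ∑ t ∈ Finset.Icc 1 N, g (Nat.dist s t) ≤ N * (2 * G) := by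
  have row : ∀ s ∈ Finset.Icc 1 N, ∑ t ∈ Finset.Icc 1 N, g (Nat.dist s t) ≤ 2 * G := by
    intro s hs
    rw [← Finset.sum_filter_add_sum_filter_not _ (fun t => s ≤ t), two_mul]
    refine add_le_add ((?_ : _ ≤ ∑ l ∈ Finset.range (N + 1), g l).trans (hG _))
      ((?_ : _ ≤ ∑ l ∈ Finset.range (N + 1), g l).trans (hG _))
    · rw [← Finset.sum_image (f := g) (g := fun t => Nat.dist s t)]
      · refine Finset.sum_le_sum_of_subset_of_nonneg ?_ fun _ _ _ => hg _
        intro l hl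
        simp only [Finset.mem_image, Finset.mem_filter, Finset.mem_Icc, Finset.mem_range,
          Nat.dist] at *
        omega
      · intro a ha b hb hab
        simp only [Finset.coe_filter, Set.mem_ofPred_eq, Nat.dist] at *
        omega
    · rw [← Finset.sum_image (f := g) (g := fun t => Nat.dist s t)]
      · refine Finset.sum_le_sum_of_subset_of_nonneg ?_ fun _ _ _ => hg _
        intro l hl
        simp only [Finset.mem_image, Finset.mem_filter, Finset.mem_Icc, Finset.mem_range,
          Nat.dist] at *
        omega
      · intro a ha b hb hab
        simp only [Finset.coe_filter, Set.mem_ofPred_eq, Nat.dist] at *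
        omega
  refine (Finset.sum_le_sum row).trans ?_
  simp

theorem sq_integral_abs_le {P : Measure Ω} [IsProbabilityMeasure P] {X : Ω → ℝ}
    (hX : MemLp X 2 P) : (∫ ω, |X ω| ∂P) ^ 2 ≤ ∫ ω, X ω ^ 2 ∂P := by
  have h := variance_eq_sub hX.abs
  have h0 := variance_nonneg (fun ω => |X ω|) P
  have e : ∫ ω, ((fun ω => |X ω|) ^ 2) ω ∂P = ∫ ω, X ω ^ 2 ∂P :=
    integral_congr_ae (Eventually.of_forall fun ω => sq_abs (X ω))
  have h' : Var[fun ω => |X ω|; P] = ∫ ω, X ω ^ 2 ∂P - (∫ ω, |X ω| ∂P) ^ 2 := by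
    rw [← e]; exact h
  linarith

/-- Covariances of square integrable variables are bounded by a common second moment bound. -/
theorem abs_cov_le_of_sq_le {P : Measure Ω} [IsProbabilityMeasure P] {X Y : Ω → ℝ} {K : ℝ}
    (hX : MemLp X 2 P) (hY : MemLp Y 2 P) (hXK : ∫ ω, X ω ^ 2 ∂P ≤ K)
    (hYK : ∫ ω, Y ω ^ 2 ∂P ≤ K) : |cov[X, Y; P]| ≤ K := by
  have hv : ∀ Z : Ω → ℝ, MemLp Z 2 P → ∫ ω, Z ω ^ 2 ∂P ≤ K → Var[Z; P] ≤ K := by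
    intro Z hZ hZK
    have := variance_eq_sub hZ
    have e : ∫ ω, (Z ^ 2) ω ∂P = ∫ ω, Z ω ^ 2 ∂P := rfl
    nlinarith [sq_nonneg (∫ ω, Z ω ∂P)]
  have h1 := variance_nonneg (X + Y) P
  have h2 := variance_nonneg (X - Y) P
  rw [variance_add hX hY] at h1
  rw [variance_sub hX hY] at h2
  rw [abs_le]
  constructor <;> linarith [hv X hX hXK, hv Y hY hYK]

/-- Sums of a square integrable function of two observations at lag `k`, along a strictly
stationary `ψ`-mixing process, have variance of the order of the number of summands. -/
theorem variance_sum_le {d : ℕ} (P : Measure Ω) [IsProbabilityMeasure P]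
    {y : ℤ → Ω → Fin d → ℝ} (hy : ∀ t, Measurable (y t)) (hstat : IsStrictlyStationary P y)
    {K : ℝ≥0}
    (hK : ∑' t : ℕ, ((t + 1 : ℕ) : ℝ≥0∞) * psiMix P y (t + 1) ^ (1 / 2 : ℝ) ≤ K)
    (k : ℕ) {F : (Fin d → ℝ) × (Fin d → ℝ) → ℝ} (hF : Measurable F) (V : ℝ)
    (hF2 : ∀ t : ℤ, MemLp (fun ω => F (y (t + k) ω, y t ω)) 2 P)
    (hV : ∀ t : ℤ, ∫ ω, F (y (t + k) ω, y t ω) ^ 2 ∂P ≤ V) (N : ℕ) :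
    Var[fun ω => ∑ t ∈ Finset.Icc 1 N, F (y ((t : ℤ) + k) ω, y t ω); P] ≤
      N * (2 * (V * (k + 1 + K ^ 2))) := by
  set ξ : ℤ → Ω → ℝ := fun t ω => F (y (t + k) ω, y t ω) with hξ
  obtain ⟨hfin, hsum⟩ := psiMix_bounds hK
  have hV0 : 0 ≤ V := (integral_nonneg fun ω => sq_nonneg _).trans (hV 0)
  have hcov : ∀ s t : ℤ, |cov[ξ s, ξ t; P]| ≤ V := fun s t =>
    abs_cov_le_of_sq_le (hF2 s) (hF2 t) (hV s) (hV t)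
  -- At lags above `k`, shift time so that the earlier variable lives in the past up to time `0`.
  have hfar : ∀ (s : ℤ) (l : ℕ), |cov[ξ s, ξ (s + k + l + 1); P]| ≤
      V * (psiMix P y (l + 1)).toReal := by
    intro s l
    have m : Measurable fun ω (t : ℤ) => y (t + (s + k)) ω := measurable_pi_lambda _ fun t => hy _
    have m0 : Measurable fun ω (t : ℤ) => y (t + 0) ω := measurable_pi_lambda _ fun t => hy _
    have mF : ∀ a b : ℤ, Measurable fun z : ℤ → Fin d → ℝ => F (z a, z b) := fun a b =>
      hF.comp ((measurable_pi_apply a).prodMk (measurable_pi_apply b))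
    have e : cov[ξ s, ξ (s + k + l + 1); P] = cov[ξ (-k), ξ (l + 1 : ℕ); P] := by
      have e1 := covariance_map_fun (μ := P) (X := fun z : ℤ → Fin d → ℝ => F (z 0, z (-k)))
        (Y := fun z : ℤ → Fin d → ℝ => F (z ((l + 1 : ℕ) + k), z (l + 1 : ℕ)))
        (mF _ _).aestronglyMeasurable (mF _ _).aestronglyMeasurable m.aemeasurable
      have e2 := covariance_map_fun (μ := P) (X := fun z : ℤ → Fin d → ℝ => F (z 0, z (-k)))
        (Y := fun z : ℤ → Fin d → ℝ => F (z ((l + 1 : ℕ) + k), z (l + 1 : ℕ)))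
        (mF _ _).aestronglyMeasurable (mF _ _).aestronglyMeasurable m0.aemeasurable
      rw [hstat (s + k)] at e1
      rw [hstat 0] at e2
      rw [e2] at e1
      convert e1.symm using 2
      · ext ω
        simp only [hξ]
        congr 3 <;> ring
      · ext ω
        simp only [hξ]
        congr 3 <;> push_cast <;> ring
      · ext ω
        simp only [hξ]
        congr 3 <;> ring
      · ext ω
        simp only [hξ]
        congr 3
    rw [e]
    have hX : Measurable[past y] (ξ (-k)) := by
      refine hF.comp (Measurable.prodMk ?_ ?_)
      · exact measurable_past y (by omega)
      · exact measurable_past y (by omega)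
    have hY : Measurable[future y (l + 1)] (ξ (l + 1 : ℕ)) := by
      refine hF.comp (Measurable.prodMk ?_ ?_)
      · exact measurable_future y (by omega)
      · exact measurable_future y (by omega)
    refine (abs_cov_le_psiMix P hy (hfin l) hX hY (hF2 _) (hF2 _)).trans ?_
    rw [mul_comm]
    refine mul_le_mul_of_nonneg_right ?_ ENNReal.toReal_nonneg
    have a1 := (sq_integral_abs_le (hF2 (-k))).trans (hV (-k))
    have a2 := (sq_integral_abs_le (hF2 (l + 1 : ℕ))).trans (hV (l + 1 : ℕ))
    nlinarith [sq_nonneg (∫ ω, |ξ (-k) ω| ∂P - ∫ ω, |ξ (l + 1 : ℕ) ω| ∂P)]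
  let g : ℕ → ℝ := fun l => if l ≤ k then V else V * (psiMix P y (l - (k + 1) + 1)).toReal
  have hg0 : ∀ l, 0 ≤ g l := fun l => by
    dsimp only [g]
    split_ifs
    exacts [hV0, mul_nonneg hV0 ENNReal.toReal_nonneg]
  have hG : ∀ N, ∑ l ∈ Finset.range N, g l ≤ V * (k + 1 + K ^ 2) := by
    intro N
    calc ∑ l ∈ Finset.range N, g l ≤ ∑ l ∈ Finset.range ((k + 1) + N), g l :=
          Finset.sum_le_sum_of_subset_of_nonneg (Finset.range_mono (by omega)) fun _ _ _ => hg0 _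
      _ = ∑ l ∈ Finset.range (k + 1), V +
            ∑ l ∈ Finset.range N, V * (psiMix P y (l + 1)).toReal := by
          rw [Finset.sum_range_add]
          congr 1
          · refine Finset.sum_congr rfl fun l hl => ?_
            rw [Finset.mem_range] at hl
            exact if_pos (by omega)
          · refine Finset.sum_congr rfl fun l hl => ?_
            dsimp only [g]
            rw [if_neg (by omega), Nat.add_sub_cancel_left]
      _ ≤ _ := by
          rw [← Finset.mul_sum, Finset.sum_const, Finset.card_range, nsmul_eq_mul]
          have := mul_le_mul_of_nonneg_left (hsum N) hV0
          push_cast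
          linarith
  have hst : ∀ s t : ℕ, |cov[ξ s, ξ t; P]| ≤ g (Nat.dist s t) := by
    have hlt : ∀ s t : ℕ, s ≤ t → |cov[ξ s, ξ t; P]| ≤ g (t - s) := by
      intro s t h
      dsimp only [g]
      split_ifs with h1
      · exact hcov _ _
      · have h2 := hfar s (t - s - (k + 1))
        have h3 : (s : ℤ) + k + ((t - s - (k + 1) : ℕ) : ℤ) + 1 = t := by omega
        rwa [h3] at h2
    intro s t
    rcases le_total s t with h | h
    · rw [Nat.dist_eq_sub_of_le h]; exact hlt s t h
    · rw [Nat.dist_comm, Nat.dist_eq_sub_of_le h, covariance_comm]; exact hlt t s h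
  have hm : ∀ t ∈ Finset.Icc 1 N, MemLp (ξ (t : ℕ)) 2 P := fun t _ => hF2 t
  have hvar : Var[fun ω => ∑ t ∈ Finset.Icc 1 N, ξ (t : ℕ) ω; P] =
      ∑ s ∈ Finset.Icc 1 N, ∑ t ∈ Finset.Icc 1 N, cov[ξ s, ξ t; P] := by
    rw [← covariance_self, covariance_fun_sum_fun_sum' hm hm]
    exact (memLp_finsetSum _ hm).aemeasurable
  change Var[fun ω => ∑ t ∈ Finset.Icc 1 N, ξ (t : ℕ) ω; P] ≤ _
  rw [hvar]
  refine le_trans ?_ (sum_sum_dist_le g hg0 _ hG N)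
  exact Finset.sum_le_sum fun s _ => Finset.sum_le_sum fun t _ => (le_abs_self _).trans (hst s t)

end Variance

/-! ### Deviation of the sample autocovariances -/

section Deviation

/-- The bound for `sampleCov - lagCov` that has a finite expectation of the right order: products of
averages are bounded by sums of their squares, so that second moments suffice. -/
theorem frobNorm_le_of_decomp {d : ℕ} (G T S : Matrix (Fin d) (Fin d) ℝ) (w u c : Fin d → ℝ)
    (ρ κ s a : ℝ) (ha : 0 < a) (hρ0 : 0 ≤ ρ) (hρ1 : ρ ≤ 1) (hκ : 1 - ρ ≤ κ)
    (hS : ∀ i j, |S i j| ≤ s) (hs : 0 ≤ s)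
    (hG : ∀ i j, G i j = T i j - w i * c j - c i * u j + ρ * (c i * c j) - (1 - ρ) * S i j) :
    frobNorm G ≤ 3 * (a + a⁻¹ * (∑ i, ∑ j, T i j ^ 2) + ∑ i, w i ^ 2 + ∑ i, u i ^ 2 + ∑ i, c i ^ 2
      + κ * s * d) := by
  set T2 := ∑ i, ∑ j, T i j ^ 2 with hT2
  set W := ∑ i, w i ^ 2 with hW
  set U := ∑ i, u i ^ 2 with hU
  set C := ∑ i, c i ^ 2 with hC
  have T0 : 0 ≤ T2 := Finset.sum_nonneg fun _ _ => Finset.sum_nonneg fun _ _ => sq_nonneg _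
  have W0 : 0 ≤ W := Finset.sum_nonneg fun _ _ => sq_nonneg _
  have U0 : 0 ≤ U := Finset.sum_nonneg fun _ _ => sq_nonneg _
  have C0 : 0 ≤ C := Finset.sum_nonneg fun _ _ => sq_nonneg _
  have k0 : 0 ≤ κ := by linarith
  have b0 : 0 ≤ a⁻¹ * T2 := by positivity
  have e0 : 0 ≤ κ * s * d := by positivity
  have hent : ∀ i j, G i j ^ 2 ≤ 5 * (T i j ^ 2 + w i ^ 2 * c j ^ 2 + c i ^ 2 * u j ^ 2 +
      c i ^ 2 * c j ^ 2 + (κ * s) ^ 2) := by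
    intro i j
    have h5 : ∀ x₁ x₂ x₃ x₄ x₅ : ℝ, (x₁ - x₂ - x₃ + x₄ - x₅) ^ 2 ≤
        5 * (x₁ ^ 2 + x₂ ^ 2 + x₃ ^ 2 + x₄ ^ 2 + x₅ ^ 2) := fun x₁ x₂ x₃ x₄ x₅ => by
      nlinarith [sq_nonneg (x₁ + x₂), sq_nonneg (x₁ + x₃), sq_nonneg (x₁ - x₄),
        sq_nonneg (x₁ + x₅), sq_nonneg (x₂ - x₃), sq_nonneg (x₂ + x₄), sq_nonneg (x₂ - x₅),
        sq_nonneg (x₃ + x₄), sq_nonneg (x₃ - x₅), sq_nonneg (x₄ + x₅)]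
    have h1 : (ρ * (c i * c j)) ^ 2 ≤ c i ^ 2 * c j ^ 2 := by
      rw [mul_pow, mul_pow]
      exact mul_le_of_le_one_left (by positivity) (pow_le_one₀ hρ0 hρ1)
    have h2 : ((1 - ρ) * S i j) ^ 2 ≤ (κ * s) ^ 2 := by
      rw [← sq_abs, abs_mul, abs_of_nonneg (by linarith : 0 ≤ 1 - ρ)]
      exact pow_le_pow_left₀ (by positivity)
        (mul_le_mul hκ (hS i j) (abs_nonneg _) k0) 2
    rw [hG]
    refine (h5 _ _ _ _ _).trans ?_
    rw [mul_pow (w i), mul_pow (c i)]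
    linarith
  have hsum : frobNorm G ^ 2 ≤ 5 * (T2 + W * C + C * U + C * C + (κ * s * d) ^ 2) := by
    rw [frobNorm_sq]
    refine (Finset.sum_le_sum fun i _ => Finset.sum_le_sum fun j _ => hent i j).trans_eq ?_
    simp only [← Finset.mul_sum, Finset.sum_add_distrib, ← Finset.sum_mul, Finset.sum_const,
      Finset.card_univ, Fintype.card_fin, nsmul_eq_mul, hT2, hW, hU, hC]
    ring
  have hT : T2 ≤ a * (a⁻¹ * T2) := by rw [mul_inv_cancel_left₀ ha.ne']
  refine le_of_sq_le_sq ?_ (by positivity)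
  refine hsum.trans ?_
  set b := a⁻¹ * T2
  set e := κ * s * d
  linarith [mul_nonneg ha.le b0, mul_nonneg ha.le W0, mul_nonneg ha.le U0, mul_nonneg ha.le C0,
    mul_nonneg ha.le e0, mul_nonneg b0 W0, mul_nonneg b0 U0, mul_nonneg b0 C0, mul_nonneg b0 e0,
    mul_nonneg W0 U0, mul_nonneg W0 C0, mul_nonneg W0 e0, mul_nonneg U0 C0, mul_nonneg U0 e0,
    mul_nonneg C0 e0, sq_nonneg a, sq_nonneg b, sq_nonneg W, sq_nonneg U, sq_nonneg C,
    sq_nonneg e]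

variable {Ω : Type*}

/-- The algebraic decomposition behind `frobNorm_le_of_decomp`, in terms of observations centred at
`μ`: `sampleCov - S` is a centred average of products, corrected for the estimated mean and for the
missing `k` summands. -/
theorem sampleCov_sub_apply {d : ℕ} (y : ℤ → Ω → Fin d → ℝ) (n k : ℕ) (hn : 1 ≤ n) (ω : Ω)
    (μ : Fin d → ℝ) (S : Matrix (Fin d) (Fin d) ℝ) (i j : Fin d) :
    (sampleCov y n k ω - S) i j =
      (n : ℝ)⁻¹ * ∑ t ∈ Finset.Icc 1 (n - k),
        ((y ((t : ℤ) + k) ω i - μ i) * (y t ω j - μ j) - S i j)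
      - ((n : ℝ)⁻¹ * ∑ t ∈ Finset.Icc 1 (n - k), (y ((t : ℤ) + k) ω i - μ i)) *
        ((n : ℝ)⁻¹ * ∑ t ∈ Finset.Icc 1 n, (y t ω j - μ j))
      - ((n : ℝ)⁻¹ * ∑ t ∈ Finset.Icc 1 n, (y t ω i - μ i)) *
        ((n : ℝ)⁻¹ * ∑ t ∈ Finset.Icc 1 (n - k), (y t ω j - μ j))
      + ((n - k : ℕ) : ℝ) / n * (((n : ℝ)⁻¹ * ∑ t ∈ Finset.Icc 1 n, (y t ω i - μ i)) *
        ((n : ℝ)⁻¹ * ∑ t ∈ Finset.Icc 1 n, (y t ω j - μ j)))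
      - (1 - ((n - k : ℕ) : ℝ) / n) * S i j := by
  have hn0 : (n : ℝ) ≠ 0 := by positivity
  have hmean : ∀ i, sampleMean y n ω i =
      μ i + (n : ℝ)⁻¹ * ∑ t ∈ Finset.Icc 1 n, (y t ω i - μ i) := by
    intro i
    simp only [sampleMean, Pi.smul_apply, Finset.sum_apply, smul_eq_mul, Finset.sum_sub_distrib,
      Finset.sum_const, Nat.card_Icc, nsmul_eq_mul]
    rw [Nat.add_sub_cancel]
    field_simp
    ring
  simp only [Matrix.sub_apply, sampleCov, Matrix.smul_apply, Matrix.sum_apply,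
    Matrix.vecMulVec_apply, Pi.sub_apply, smul_eq_mul, hmean]
  set a := (n : ℝ)⁻¹ * ∑ t ∈ Finset.Icc 1 n, (y t ω i - μ i)
  set b := (n : ℝ)⁻¹ * ∑ t ∈ Finset.Icc 1 n, (y t ω j - μ j)
  have hterm : ∀ t : ℕ, (y ((t : ℤ) + k) ω i - (μ i + a)) * (y t ω j - (μ j + b)) =
      (y ((t : ℤ) + k) ω i - μ i) * (y t ω j - μ j) - (y ((t : ℤ) + k) ω i - μ i) * b
        - a * (y t ω j - μ j) + a * b := fun t => by ring
  simp only [hterm, Finset.sum_add_distrib, Finset.sum_sub_distrib (fun t : ℕ =>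
    (y ((t : ℤ) + k) ω i - μ i) * (y t ω j - μ j) - (y ((t : ℤ) + k) ω i - μ i) * b),
    Finset.sum_sub_distrib (fun t : ℕ => (y ((t : ℤ) + k) ω i - μ i) * (y t ω j - μ j)),
    ← Finset.mul_sum, ← Finset.sum_mul, Finset.sum_const, Nat.card_Icc, nsmul_eq_mul,
    Nat.add_sub_cancel]
  field_simp
  ring

variable [MeasurableSpace Ω]

theorem integral_sq_sum_sub_le {d : ℕ} (P : Measure Ω) [IsProbabilityMeasure P]
    {y : ℤ → Ω → Fin d → ℝ} (hy : ∀ t, Measurable (y t)) (hstat : IsStrictlyStationary P y)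
    {K : ℝ≥0}
    (hK : ∑' t : ℕ, ((t + 1 : ℕ) : ℝ≥0∞) * psiMix P y (t + 1) ^ (1 / 2 : ℝ) ≤ K)
    (k : ℕ) {F : (Fin d → ℝ) × (Fin d → ℝ) → ℝ} (hF : Measurable F) (V m : ℝ)
    (hF2 : ∀ t : ℤ, MemLp (fun ω => F (y (t + k) ω, y t ω)) 2 P)
    (hV : ∀ t : ℤ, ∫ ω, F (y (t + k) ω, y t ω) ^ 2 ∂P ≤ V)
    (hm : ∀ t : ℤ, ∫ ω, F (y (t + k) ω, y t ω) ∂P = m) (n N : ℕ) (hn : 1 ≤ n) (hN : N ≤ n) :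
    Integrable (fun ω =>
      ((n : ℝ)⁻¹ * ∑ t ∈ Finset.Icc 1 N, (F (y ((t : ℤ) + k) ω, y t ω) - m)) ^ 2) P ∧
    ∫ ω, ((n : ℝ)⁻¹ * ∑ t ∈ Finset.Icc 1 N, (F (y ((t : ℤ) + k) ω, y t ω) - m)) ^ 2 ∂P ≤
      2 * (V * (k + 1 + K ^ 2)) / n := by
  have hn0 : (0 : ℝ) < n := by positivity
  have hV0 : 0 ≤ V := (integral_nonneg fun ω => sq_nonneg _).trans (hV 0)
  have hvar := variance_sum_le P hy hstat hK k hF V hF2 hV N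
  have hmem : MemLp (fun ω => ∑ t ∈ Finset.Icc 1 N, F (y ((t : ℤ) + k) ω, y t ω)) 2 P :=
    memLp_finsetSum _ fun t _ => hF2 t
  have hint : ∫ ω, ∑ t ∈ Finset.Icc 1 N, F (y ((t : ℤ) + k) ω, y t ω) ∂P = N * m := by
    rw [integral_finsetSum _ fun (t : ℕ) _ => (hF2 t).integrable one_le_two]
    simp [hm]
  have hcong : ∀ ω, ∑ t ∈ Finset.Icc 1 N, (F (y ((t : ℤ) + k) ω, y t ω) - m) =
      ∑ t ∈ Finset.Icc 1 N, F (y ((t : ℤ) + k) ω, y t ω) - N * m := fun ω => by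
    simp [Finset.sum_sub_distrib]
  rw [variance_eq_integral hmem.aemeasurable, hint] at hvar
  have hmem' : MemLp (fun ω => ∑ t ∈ Finset.Icc 1 N, F (y ((t : ℤ) + k) ω, y t ω) - N * m) 2 P :=
    hmem.sub (memLp_const _)
  simp only [hcong, mul_pow]
  refine ⟨hmem'.integrable_sq.const_mul _, ?_⟩
  rw [integral_const_mul]
  calc ((n : ℝ)⁻¹) ^ 2 * ∫ ω, (∑ t ∈ Finset.Icc 1 N, F (y ((t : ℤ) + k) ω, y t ω) - N * m) ^ 2 ∂P
      ≤ ((n : ℝ)⁻¹) ^ 2 * (n * (2 * (V * (k + 1 + K ^ 2)))) := by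
        refine mul_le_mul_of_nonneg_left (hvar.trans ?_) (by positivity)
        exact mul_le_mul_of_nonneg_right (by exact_mod_cast hN) (by positivity)
    _ = _ := by field_simp

/-- A bound for the fourth moments of the centred observations (and, being at least `1`, for their
second moments), in terms of the bound `K` for the fourth moments of the observations. -/
noncomputable def momentBound (K : ℝ) : ℝ := 1 + 8 * (K + (1 + K) ^ 4)

theorem centred_moment {P : Measure Ω} [IsProbabilityMeasure P] {X : Ω → ℝ} (hX : Measurable X)
    {K : ℝ≥0} (hK : ∫⁻ ω, ‖X ω‖ₑ ^ 4 ∂P ≤ K) :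
    Integrable X P ∧ Integrable (fun ω => (X ω - ∫ ω, X ω ∂P) ^ 4) P ∧
      1 + ∫ ω, (X ω - ∫ ω, X ω ∂P) ^ 4 ∂P ≤ momentBound K := by
  have e : ∀ ω, ‖X ω‖ₑ ^ 4 = ENNReal.ofReal (X ω ^ 4) := fun ω => by
    rw [← ofReal_norm, ← ENNReal.ofReal_pow (norm_nonneg _), Real.norm_eq_abs,
      Even.pow_abs (by decide)]
  have h4 : ∀ a : ℝ, 0 ≤ a ^ 4 := fun a => by positivity
  simp only [e] at hK
  have hi : Integrable (fun ω => X ω ^ 4) P := by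
    refine ⟨(hX.pow_const 4).aestronglyMeasurable, ?_⟩
    rw [hasFiniteIntegral_iff_ofReal (Eventually.of_forall fun ω => h4 _)]
    exact hK.trans_lt ENNReal.coe_lt_top
  have hle : ∫ ω, X ω ^ 4 ∂P ≤ K := by
    rw [← ofReal_integral_eq_lintegral_ofReal hi (Eventually.of_forall fun ω => h4 _)] at hK
    have := ENNReal.toReal_mono ENNReal.coe_ne_top hK
    rwa [ENNReal.toReal_ofReal (integral_nonneg fun ω => h4 _), ENNReal.coe_toReal] at this
  have h1 : ∀ a : ℝ, |a| ≤ 1 + a ^ 4 := fun a => by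
    rw [← Even.pow_abs (by decide : Even 4)]
    nlinarith [abs_nonneg a, sq_nonneg (|a| - 1), sq_nonneg (|a| ^ 2 - 1)]
  have hXi : Integrable X P :=
    ((integrable_const (1 : ℝ)).add hi).mono' hX.aestronglyMeasurable
      (Eventually.of_forall fun ω => h1 _)
  set μ := ∫ ω, X ω ∂P
  have hμ : |μ| ≤ 1 + K := by
    refine (abs_integral_le_integral_abs).trans ?_
    calc ∫ ω, |X ω| ∂P ≤ ∫ ω, (1 + X ω ^ 4) ∂P :=
          integral_mono hXi.abs ((integrable_const (1 : ℝ)).add hi) fun ω => h1 _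
      _ = 1 + ∫ ω, X ω ^ 4 ∂P := by
          rw [integral_add (integrable_const (1 : ℝ)) hi]; simp
      _ ≤ _ := by linarith
  have hμ4 : μ ^ 4 ≤ (1 + (K : ℝ)) ^ 4 := by
    rw [← Even.pow_abs (by decide : Even 4)]
    exact pow_le_pow_left₀ (abs_nonneg _) hμ 4
  have h8 : ∀ a b : ℝ, (a - b) ^ 4 ≤ 8 * (a ^ 4 + b ^ 4) := fun a b => by
    have h1 : (a - b) ^ 2 ≤ 2 * (a ^ 2 + b ^ 2) := by nlinarith [sq_nonneg (a + b)]
    have h2 : ((a - b) ^ 2) ^ 2 ≤ (2 * (a ^ 2 + b ^ 2)) ^ 2 :=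
      pow_le_pow_left₀ (sq_nonneg _) h1 2
    nlinarith [sq_nonneg (a ^ 2 - b ^ 2)]
  have hdom : Integrable (fun ω => 8 * (X ω ^ 4 + μ ^ 4)) P :=
    (hi.add (integrable_const _)).const_mul 8
  have hci : Integrable (fun ω => (X ω - μ) ^ 4) P :=
    hdom.mono' ((hX.sub_const μ).pow_const 4).aestronglyMeasurable
      (Eventually.of_forall fun ω => by
        rw [Real.norm_eq_abs, abs_of_nonneg (h4 _)]; exact h8 _ _)
  refine ⟨hXi, hci, ?_⟩
  have : ∫ ω, (X ω - μ) ^ 4 ∂P ≤ 8 * (∫ ω, X ω ^ 4 ∂P + μ ^ 4) := by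
    refine (integral_mono hci hdom fun ω => h8 _ _).trans_eq ?_
    rw [integral_const_mul, integral_add hi (integrable_const _)]
    simp
  unfold momentBound
  linarith

theorem memLp_two_of_sq_le {P : Measure Ω} {X : Ω → ℝ} {g : Ω → ℝ}
    (hX : AEStronglyMeasurable X P) (hg : Integrable g P) (h : ∀ ω, X ω ^ 2 ≤ g ω) :
    MemLp X 2 P ∧ ∫ ω, X ω ^ 2 ∂P ≤ ∫ ω, g ω ∂P := by
  have hi : Integrable (fun ω => X ω ^ 2) P :=
    hg.mono' (hX.pow 2) (Eventually.of_forall fun ω => by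
      rw [Real.norm_eq_abs, abs_of_nonneg (sq_nonneg _)]; exact h ω)
  exact ⟨(memLp_two_iff_integrable_sq hX).2 hi, integral_mono hi hg h⟩

/-- The constant in the deviation bound for the sample autocovariance at lag `k`, given the bound
`K` in the mixing and moment conditions. -/
noncomputable def deviationConst (k : ℕ) (K : ℝ) : ℝ :=
  3 * (1 + 4 * (2 * (momentBound K * (k + 1 + K ^ 2))) + k * (1 + momentBound K))

/-- The sample autocovariance matrix deviates from `lagCov` by `O_P(d / √n)` in Frobenius norm, with
a constant that depends only on the lag and on the bound in the mixing and moment conditions. -/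
theorem measure_frobNorm_gt_le {d : ℕ} (P : Measure Ω) [IsProbabilityMeasure P]
    {y : ℤ → Ω → Fin d → ℝ} (hy : ∀ t, Measurable (y t)) (hstat : IsStrictlyStationary P y)
    {K : ℝ≥0}
    (hK : ∑' t : ℕ, ((t + 1 : ℕ) : ℝ≥0∞) * psiMix P y (t + 1) ^ (1 / 2 : ℝ) ≤ K)
    (hmom : ∀ t i, ∫⁻ ω, ‖y t ω i‖ₑ ^ 4 ∂P ≤ K)
    (k n : ℕ) (hn : 1 ≤ n) (hd : 1 ≤ d) (L : ℝ) (hL : 0 < L) :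
    P {ω | L * (d / √n) < frobNorm (sampleCov y n k ω - lagCov P y k)} ≤
      ENNReal.ofReal (deviationConst k K / L) := by
  have hn0 : (0 : ℝ) < n := by positivity
  have hd0 : (0 : ℝ) < d := by positivity
  set V := momentBound K with hVdef
  set B := 2 * (V * (k + 1 + (K : ℝ) ^ 2)) with hB
  set μ : Fin d → ℝ := fun i => ∫ ω, y 0 ω i ∂P with hμ
  have mcoord : ∀ t i, Measurable fun ω => y t ω i := fun t i => (measurable_pi_apply i).comp (hy t)
  have hmean : ∀ t i, ∫ ω, y t ω i ∂P = μ i := fun t i => by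
    have := integral_comp_shift hy hstat (Φ := fun z => z 0 i)
      ((measurable_pi_apply i).comp (measurable_pi_apply 0)) t
    simpa using this
  have hcm : ∀ t i, Integrable (fun ω => y t ω i) P ∧
      Integrable (fun ω => (y t ω i - μ i) ^ 4) P ∧
      1 + ∫ ω, (y t ω i - μ i) ^ 4 ∂P ≤ V := fun t i => by
    have := centred_moment (mcoord t i) (hmom t i)
    rwa [hmean t i] at this
  have i4 : ∀ t i, 0 ≤ ∫ ω, (y t ω i - μ i) ^ 4 ∂P := fun t i =>
    integral_nonneg fun ω => by positivity
  have hV1 : 1 ≤ V := by linarith [(hcm 0 ⟨0, hd⟩).2.2, i4 0 ⟨0, hd⟩]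
  have hB0 : 0 ≤ B := by positivity
  -- Second moments of the centred observations and of their lagged products.
  have single : ∀ t i, MemLp (fun ω => y t ω i - μ i) 2 P ∧
      ∫ ω, (y t ω i - μ i) ^ 2 ∂P ≤ V := by
    intro t i
    have h := memLp_two_of_sq_le (P := P) (X := fun ω => y t ω i - μ i)
      (g := fun ω => 1 + (y t ω i - μ i) ^ 4)
      ((mcoord t i).sub_const _).aestronglyMeasurable
      ((integrable_const (1 : ℝ)).add (hcm t i).2.1)
      (fun ω => by nlinarith [sq_nonneg ((y t ω i - μ i) ^ 2 - 1)])
    refine ⟨h.1, h.2.trans ?_⟩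
    rw [integral_add (integrable_const (1 : ℝ)) (hcm t i).2.1]
    simpa using (hcm t i).2.2
  have prod : ∀ (t : ℤ) i j, MemLp (fun ω => (y (t + k) ω i - μ i) * (y t ω j - μ j)) 2 P ∧
      ∫ ω, ((y (t + k) ω i - μ i) * (y t ω j - μ j)) ^ 2 ∂P ≤ V := by
    intro t i j
    have h := memLp_two_of_sq_le (P := P) (X := fun ω => (y (t + k) ω i - μ i) * (y t ω j - μ j))
      (g := fun ω => 2⁻¹ * ((y (t + k) ω i - μ i) ^ 4 + (y t ω j - μ j) ^ 4))
      (((mcoord (t + k) i).sub_const _).mul ((mcoord t j).sub_const _)).aestronglyMeasurable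
      (((hcm (t + k) i).2.1.add (hcm t j).2.1).const_mul _)
      (fun ω => by nlinarith [sq_nonneg ((y (t + k) ω i - μ i) ^ 2 - (y t ω j - μ j) ^ 2)])
    refine ⟨h.1, h.2.trans ?_⟩
    rw [integral_const_mul, integral_add (hcm (t + k) i).2.1 (hcm t j).2.1]
    linarith [(hcm (t + k) i).2.2, (hcm t j).2.2]
  have msingle0 : ∀ t i, ∫ ω, (y t ω i - μ i) ∂P = 0 := fun t i => by
    rw [integral_sub (hcm t i).1 (integrable_const _), hmean]
    simp
  have mprod : ∀ (t : ℤ) i j,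
      ∫ ω, (y (t + k) ω i - μ i) * (y t ω j - μ j) ∂P = lagCov P y k i j := by
    intro t i j
    have := integral_comp_shift hy hstat (Φ := fun z => (z k i - μ i) * (z 0 j - μ j)) (by fun_prop) t
    simp only [zero_add, add_comm (k : ℤ) t] at this
    rw [this]
    simp only [lagCov, covMat, Matrix.of_apply, covariance, hmean]
  have hSle : ∀ i j, |lagCov P y k i j| ≤ 1 + V := by
    intro i j
    rw [← mprod 0 i j]
    refine abs_integral_le_integral_abs.trans ?_
    have h1 := sq_integral_abs_le (prod 0 i j).1
    have h2 := (prod 0 i j).2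
    nlinarith [sq_nonneg (∫ ω, |(y (0 + k) ω i - μ i) * (y 0 ω j - μ j)| ∂P - 1)]
  have mi : ∀ i : Fin d, Measurable fun z : (Fin d → ℝ) × (Fin d → ℝ) => z.1 i - μ i := fun i =>
    ((measurable_pi_apply i).comp measurable_fst).sub_const _
  have mj : ∀ i : Fin d, Measurable fun z : (Fin d → ℝ) × (Fin d → ℝ) => z.2 i - μ i := fun i =>
    ((measurable_pi_apply i).comp measurable_snd).sub_const _
  let T : Ω → Matrix (Fin d) (Fin d) ℝ := fun ω => Matrix.of fun i j =>
    (n : ℝ)⁻¹ * ∑ t ∈ Finset.Icc 1 (n - k),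
        ((y ((t : ℤ) + k) ω i - μ i) * (y t ω j - μ j) - lagCov P y k i j)
  let w : Ω → Fin d → ℝ := fun ω i =>
    (n : ℝ)⁻¹ * ∑ t ∈ Finset.Icc 1 (n - k), (y ((t : ℤ) + k) ω i - μ i)
  let u : Ω → Fin d → ℝ := fun ω i => (n : ℝ)⁻¹ * ∑ t ∈ Finset.Icc 1 (n - k), (y t ω i - μ i)
  let c : Ω → Fin d → ℝ := fun ω i => (n : ℝ)⁻¹ * ∑ t ∈ Finset.Icc 1 n, (y t ω i - μ i)
  have hT : ∀ i j, Integrable (fun ω => T ω i j ^ 2) P ∧ ∫ ω, T ω i j ^ 2 ∂P ≤ B / n := fun i j =>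
    integral_sq_sum_sub_le P hy hstat hK k (F := fun z => (z.1 i - μ i) * (z.2 j - μ j))
      ((mi i).mul (mj j)) V _ (fun t => (prod t i j).1) (fun t => (prod t i j).2)
      (fun t => mprod t i j) n (n - k) hn (Nat.sub_le _ _)
  have hw : ∀ i, Integrable (fun ω => w ω i ^ 2) P ∧ ∫ ω, w ω i ^ 2 ∂P ≤ B / n := fun i => by
    have := integral_sq_sum_sub_le P hy hstat hK k (F := fun z => z.1 i - μ i) (mi i) V 0
      (fun t => (single _ i).1) (fun t => (single _ i).2) (fun t => msingle0 _ i) n (n - k) hn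
      (Nat.sub_le _ _)
    simpa only [sub_zero] using this
  have hu : ∀ i, Integrable (fun ω => u ω i ^ 2) P ∧ ∫ ω, u ω i ^ 2 ∂P ≤ B / n := fun i => by
    have := integral_sq_sum_sub_le P hy hstat hK k (F := fun z => z.2 i - μ i) (mj i) V 0
      (fun t => (single _ i).1) (fun t => (single _ i).2) (fun t => msingle0 _ i) n (n - k) hn
      (Nat.sub_le _ _)
    simpa only [sub_zero] using this
  have hc : ∀ i, Integrable (fun ω => c ω i ^ 2) P ∧ ∫ ω, c ω i ^ 2 ∂P ≤ B / n := fun i => by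
    have := integral_sq_sum_sub_le P hy hstat hK k (F := fun z => z.2 i - μ i) (mj i) V 0
      (fun t => (single _ i).1) (fun t => (single _ i).2) (fun t => msingle0 _ i) n n hn le_rfl
    simpa only [sub_zero] using this
  set a : ℝ := d / √n with ha
  have ha0 : 0 < a := by positivity
  have hsum1 : ∀ q : Ω → Fin d → ℝ,
      (∀ i, Integrable (fun ω => q ω i ^ 2) P ∧ ∫ ω, q ω i ^ 2 ∂P ≤ B / n) →
      Integrable (fun ω => ∑ i, q ω i ^ 2) P ∧ ∫ ω, ∑ i, q ω i ^ 2 ∂P ≤ B * a := by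
    intro q hq
    refine ⟨integrable_finsetSum _ fun i _ => (hq i).1, ?_⟩
    rw [integral_finsetSum _ fun i _ => (hq i).1]
    refine (Finset.sum_le_sum fun i _ => (hq i).2).trans ?_
    rw [Finset.sum_const, Finset.card_univ, Fintype.card_fin, nsmul_eq_mul, ha]
    have hs : √(n : ℝ) ≤ n := Real.sqrt_le_iff.2 ⟨hn0.le, by
      rw [pow_two]; exact le_mul_of_one_le_left hn0.le (by exact_mod_cast hn)⟩
    calc (d : ℝ) * (B / n) = B * (d / n) := by ring
      _ ≤ B * (d / √n) := by gcongr
  have hT2 : Integrable (fun ω => ∑ i, ∑ j, T ω i j ^ 2) P ∧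
      ∫ ω, ∑ i, ∑ j, T ω i j ^ 2 ∂P ≤ B * a ^ 2 := by
    have hi : ∀ i, Integrable (fun ω => ∑ j, T ω i j ^ 2) P := fun i =>
      integrable_finsetSum _ fun j _ => (hT i j).1
    refine ⟨integrable_finsetSum _ fun i _ => hi i, ?_⟩
    rw [integral_finsetSum _ fun i _ => hi i]
    have : ∀ i ∈ (Finset.univ : Finset (Fin d)), ∫ ω, ∑ j, T ω i j ^ 2 ∂P ≤ d * (B / n) := by
      intro i _
      rw [integral_finsetSum _ fun j _ => (hT i j).1]
      refine (Finset.sum_le_sum fun j _ => (hT i j).2).trans_eq ?_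
      simp
    refine (Finset.sum_le_sum this).trans_eq ?_
    rw [Finset.sum_const, Finset.card_univ, Fintype.card_fin, nsmul_eq_mul, ha, div_pow,
      Real.sq_sqrt hn0.le]
    ring
  let κ : ℝ := k / n
  let R : Ω → ℝ := fun ω => 3 * (a + a⁻¹ * (∑ i, ∑ j, T ω i j ^ 2) + ∑ i, w ω i ^ 2
    + ∑ i, u ω i ^ 2 + ∑ i, c ω i ^ 2 + κ * (1 + V) * d)
  have hR : ∀ ω, frobNorm (sampleCov y n k ω - lagCov P y k) ≤ R ω := by
    intro ω
    have hle : ((n - k : ℕ) : ℝ) ≤ n := by exact_mod_cast Nat.sub_le _ _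
    have hge : (n : ℝ) - k ≤ ((n - k : ℕ) : ℝ) := by
      rw [sub_le_iff_le_add]; exact_mod_cast (by omega : n ≤ n - k + k)
    refine frobNorm_le_of_decomp _ (T ω) (lagCov P y k) (w ω) (u ω) (c ω)
      (((n - k : ℕ) : ℝ) / n) κ (1 + V) a ha0 (by positivity) ((div_le_one hn0).2 hle) ?_ hSle
      (by linarith) (fun i j => sampleCov_sub_apply y n k hn ω μ _ i j)
    simp only [κ]
    rw [sub_le_iff_le_add, ← add_div, le_div_iff₀ hn0]
    linarith
  have hR0 : ∀ ω, 0 ≤ R ω := fun ω => (frobNorm_nonneg _).trans (hR ω)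
  have j1 := (integrable_const a (μ := P)).add (hT2.1.const_mul a⁻¹)
  have j2 := j1.add (hsum1 w hw).1
  have j3 := j2.add (hsum1 u hu).1
  have j4 := j3.add (hsum1 c hc).1
  have j5 := j4.add (integrable_const (κ * (1 + V) * d) (μ := P))
  have hRi : Integrable R P := j5.const_mul 3
  have hRint : ∫ ω, R ω ∂P ≤ deviationConst k K * a := by
    have e : ∫ ω, R ω ∂P = 3 * (a + a⁻¹ * (∫ ω, ∑ i, ∑ j, T ω i j ^ 2 ∂P) + ∫ ω, ∑ i, w ω i ^ 2 ∂P
        + ∫ ω, ∑ i, u ω i ^ 2 ∂P + ∫ ω, ∑ i, c ω i ^ 2 ∂P + κ * (1 + V) * d) := by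
      refine (integral_const_mul _ _).trans ?_
      congr 1
      refine (integral_add j4 (integrable_const _)).trans ?_
      congr 1
      · refine (integral_add j3 (hsum1 c hc).1).trans ?_
        congr 1
        refine (integral_add j2 (hsum1 u hu).1).trans ?_
        congr 1
        refine (integral_add j1 (hsum1 w hw).1).trans ?_
        congr 1
        refine (integral_add (integrable_const a) (hT2.1.const_mul a⁻¹)).trans ?_
        rw [integral_const_mul]
        simp
      · simp
    have h1 : a⁻¹ * (∫ ω, ∑ i, ∑ j, T ω i j ^ 2 ∂P) ≤ B * a := by
      refine (mul_le_mul_of_nonneg_left hT2.2 (by positivity)).trans_eq ?_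
      field_simp
    have h2 : κ * (1 + V) * d ≤ k * (1 + V) * a := by
      have hs : √(n : ℝ) ≤ n := Real.sqrt_le_iff.2 ⟨hn0.le, by
      rw [pow_two]; exact le_mul_of_one_le_left hn0.le (by exact_mod_cast hn)⟩
      calc κ * (1 + V) * d = k * (1 + V) * (d / n) := by simp only [κ]; ring
        _ ≤ k * (1 + V) * (d / √n) := by gcongr
    have e2 : deviationConst k K * a = 3 * (a + 4 * (B * a) + k * (1 + V) * a) := by
      simp only [deviationConst, hB, hVdef]; ring
    rw [e, e2]
    linarith [(hsum1 w hw).2, (hsum1 u hu).2, (hsum1 c hc).2]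
  calc P {ω | L * a < frobNorm (sampleCov y n k ω - lagCov P y k)}
      ≤ P {ω | ENNReal.ofReal (L * a) ≤ ENNReal.ofReal (R ω)} :=
        measure_mono fun ω hω => ENNReal.ofReal_le_ofReal (le_of_lt (lt_of_lt_of_le hω (hR ω)))
    _ ≤ (∫⁻ ω, ENNReal.ofReal (R ω) ∂P) / ENNReal.ofReal (L * a) :=
        meas_ge_le_lintegral_div hRi.aestronglyMeasurable.aemeasurable.ennreal_ofReal
          (by simpa using mul_pos hL ha0) ENNReal.ofReal_ne_top
    _ = ENNReal.ofReal ((∫ ω, R ω ∂P) / (L * a)) := by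
        rw [← ofReal_integral_eq_lintegral_ofReal hRi (Eventually.of_forall hR0),
          ENNReal.ofReal_div_of_pos (mul_pos hL ha0)]
    _ ≤ _ := by
        refine ENNReal.ofReal_le_ofReal ?_
        rw [div_le_div_iff₀ (mul_pos hL ha0) hL]
        nlinarith [mul_le_mul_of_nonneg_right hRint hL.le]

end Deviation

/-! ### The autocovariances of the factor model -/

section Model

variable {Ω : Type*} [MeasurableSpace Ω]

theorem covMat_transpose {a b : ℕ} (P : Measure Ω) (U : Ω → Fin a → ℝ) (V : Ω → Fin b → ℝ) :
    (covMat P U V)ᵀ = covMat P V U := by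
  ext i j
  simp [covMat, covariance_comm]

theorem covMat_mulVec_add_left {a b c : ℕ} (P : Measure Ω) [IsProbabilityMeasure P]
    (A : Matrix (Fin a) (Fin b) ℝ) (U : Ω → Fin b → ℝ) (E : Ω → Fin a → ℝ) (V : Ω → Fin c → ℝ)
    (hU : ∀ i, MemLp (fun ω => U ω i) 2 P) (hE : ∀ i, MemLp (fun ω => E ω i) 2 P)
    (hV : ∀ i, MemLp (fun ω => V ω i) 2 P) :
    covMat P (fun ω => A *ᵥ U ω + E ω) V = A * covMat P U V + covMat P E V := by
  ext i j
  have h1 : ∀ l ∈ (Finset.univ : Finset (Fin b)), MemLp (fun ω => A i l * U ω l) 2 P :=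
    fun l _ => (hU l).const_mul _
  have e : (fun ω => (A *ᵥ U ω + E ω) i) =
      (fun ω => ∑ l, A i l * U ω l) + fun ω => E ω i := by
    ext ω
    simp [Matrix.mulVec, dotProduct]
  simp only [covMat, Matrix.of_apply, Matrix.add_apply, Matrix.mul_apply]
  rw [e, covariance_add_left (memLp_finsetSum _ h1) (hE i) (hV j), covariance_fun_sum_left' h1 (hV j)]
  simp only [covariance_const_mul_left]

/-- At positive lags the range of the autocovariance matrix of the observations is contained in that
of the loading matrix, because the noise is uncorrelated over time and with earlier factors. -/
theorem lagCov_factorModel {d r : ℕ} {P : Measure Ω} [IsProbabilityMeasure P]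
    {y : ℤ → Ω → Fin d → ℝ} {A : Matrix (Fin d) (Fin r) ℝ} {x : ℤ → Ω → Fin r → ℝ}
    {ε : ℤ → Ω → Fin d → ℝ} (hmodel : IsFactorModel P y A x ε)
    (hfactor : IsStationaryFactor P x ε) {k : ℕ} (hk : 1 ≤ k) :
    lagCov P y k = A * (lagCov P x k * Aᵀ + covMat P (x k) (ε 0)) := by
  obtain ⟨μ, S, hε⟩ := hmodel.noise
  have hx := hfactor.stationary.memLp
  have he := hε.memLp
  have hy : ∀ t, y t = fun ω => A *ᵥ x t ω + ε t ω := fun t => funext (hmodel.decomp t)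
  have hyL : ∀ t i, MemLp (fun ω => y t ω i) 2 P := by
    intro t i
    have e : (fun ω => y t ω i) = (fun ω => ∑ l, A i l * x t ω l) + fun ω => ε t ω i := by
      ext ω
      simp [hmodel.decomp, Matrix.mulVec, dotProduct]
    rw [e]
    exact (memLp_finsetSum _ fun l _ => (hx t l).const_mul _).add (he t i)
  have hεx : covMat P (ε k) (x 0) = 0 := by
    have := hfactor.uncorrelated 0 k
    rw [zero_add] at this
    rw [← covMat_transpose, this, Matrix.transpose_zero]
  have hεε : covMat P (ε k) (ε 0) = 0 := hε.cov_ne _ _ (by omega)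
  have right : ∀ {c : ℕ} (V : Ω → Fin c → ℝ), (∀ i, MemLp (fun ω => V ω i) 2 P) →
      covMat P V (y 0) = covMat P V (x 0) * Aᵀ + covMat P V (ε 0) := by
    intro c V hV
    rw [← covMat_transpose, hy 0, covMat_mulVec_add_left P A _ _ V (hx 0) (he 0) hV,
      Matrix.transpose_add, Matrix.transpose_mul, covMat_transpose, covMat_transpose]
  rw [lagCov, hy k, covMat_mulVec_add_left P A _ _ _ (hx k) (he k) (hyL 0), right _ (he k),
    right _ (hx k), hεx, hεε, Matrix.zero_mul, add_zero, add_zero]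
  rfl

theorem euclNorm_lagCov_transpose_le {d r : ℕ} (A : Matrix (Fin d) (Fin r) ℝ) (hA : Aᵀ * A = 1)
    (X : Matrix (Fin r) (Fin r) ℝ) (E : Matrix (Fin r) (Fin d) ℝ) (v : Fin d → ℝ) :
    euclNorm ((A * (X * Aᵀ + E))ᵀ *ᵥ v) ≤ (specNorm X + specNorm E) * euclNorm v := by
  have e : (A * (X * Aᵀ + E))ᵀ *ᵥ v = A *ᵥ (Xᵀ *ᵥ (Aᵀ *ᵥ v)) + Eᵀ *ᵥ (Aᵀ *ᵥ v) := by
    simp only [Matrix.transpose_mul, Matrix.transpose_add, Matrix.transpose_transpose,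
      ← Matrix.mulVec_mulVec, Matrix.add_mulVec]
  have h1 := euclNorm_transpose_mulVec_le_of_orthonormal hA v
  rw [e]
  refine (euclNorm_add_le _ _).trans ?_
  rw [euclNorm_mulVec_of_orthonormal hA, add_mul]
  exact add_le_add
    ((euclNorm_transpose_mulVec_le _ _).trans (mul_le_mul_of_nonneg_left h1 (specNorm_nonneg _)))
    ((euclNorm_transpose_mulVec_le _ _).trans (mul_le_mul_of_nonneg_left h1 (specNorm_nonneg _)))

theorem le_euclNorm_lagCov_transpose {d r : ℕ} (A : Matrix (Fin d) (Fin r) ℝ) (hA : Aᵀ * A = 1)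
    (X : Matrix (Fin r) (Fin r) ℝ) (hX : X.det ≠ 0) (E : Matrix (Fin r) (Fin d) ℝ)
    (u : Fin r → ℝ) :
    (minNorm X - specNorm E) * euclNorm u ≤ euclNorm ((A * (X * Aᵀ + E))ᵀ *ᵥ (A *ᵥ u)) := by
  have e : A *ᵥ (Xᵀ *ᵥ u) = (A * (X * Aᵀ + E))ᵀ *ᵥ (A *ᵥ u) + -(Eᵀ *ᵥ u) := by
    have h : Aᵀ *ᵥ (A *ᵥ u) = u := by rw [Matrix.mulVec_mulVec, hA, Matrix.one_mulVec]
    simp only [Matrix.transpose_mul, Matrix.transpose_add, Matrix.transpose_transpose,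
      ← Matrix.mulVec_mulVec, Matrix.add_mulVec, h]
    abel
  have h1 := minNorm_mul_euclNorm_le X hX u
  have h2 := euclNorm_transpose_mulVec_le E u
  have h3 := euclNorm_add_le ((A * (X * Aᵀ + E))ᵀ *ᵥ (A *ᵥ u)) (-(Eᵀ *ᵥ u))
  rw [← e, euclNorm_neg, euclNorm_mulVec_of_orthonormal hA] at h3
  linarith

end Model

/-! ### Asymptotics along the array -/

section Array

variable {Ω : ℕ → Type*} [∀ m, MeasurableSpace (Ω m)]

theorem IsBigOP.tendstoZeroInProb {P : ∀ m, Measure (Ω m)} {X : ∀ m, Ω m → ℝ} {a : ℕ → ℝ}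
    (h : IsBigOP P X a) (ha : Tendsto a atTop (𝓝 0)) : TendstoZeroInProb P X := by
  intro η hη
  rw [ENNReal.tendsto_nhds_zero]
  intro e he
  obtain ⟨C, hC⟩ := h e he
  have h0 : Tendsto (fun m => C * |a m|) atTop (𝓝 0) := by
    simpa using (ha.abs.const_mul C)
  filter_upwards [hC, h0.eventually (gt_mem_nhds hη)] with m h1 h2
  exact (measure_mono fun ω hω => lt_of_lt_of_le h2 hω).trans h1

theorem WithProbTendingToOne.mono {P : ∀ m, Measure (Ω m)} {E F : ∀ m, Set (Ω m)}
    (h : WithProbTendingToOne P E) (hEF : ∀ᶠ m in atTop, E m ⊆ F m) :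
    WithProbTendingToOne P F :=
  tendsto_of_tendsto_of_tendsto_of_le_of_le' tendsto_const_nhds h
    (Eventually.of_forall fun _ => zero_le)
    (hEF.mono fun _ hm => measure_mono (Set.compl_subset_compl.2 hm))

/-- Deterministic bounds for the estimated eigenvalues in terms of a bound `D` for the deviations of
the sample autocovariances. All `r` leading ones are of order `p^{2 - 2δ}` if `D` is small against
`p^{1 - δ}`, while the next one is at most of order `D²`. -/
theorem eventually_estEig_bounds {P : ∀ m, Measure (Ω m)} [∀ m, IsProbabilityMeasure (P m)]
    {r k₀ : ℕ} (hr : 1 ≤ r) (hk₀ : 1 ≤ k₀) {δ : ℝ} (n : ℕ → ℕ) {p : ℕ → ℕ}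
    (hp : Tendsto p atTop atTop)
    {y : ∀ m, ℤ → Ω m → Fin (p m) → ℝ} {A : ∀ m, Matrix (Fin (p m)) (Fin r) ℝ}
    {x : ∀ m, ℤ → Ω m → Fin r → ℝ} {ε : ∀ m, ℤ → Ω m → Fin (p m) → ℝ}
    (hmodel : ∀ m, IsFactorModel (P m) (y m) (A m) (x m) (ε m))
    (hfactor : ∀ m, IsStationaryFactor (P m) (x m) (ε m))
    (hstrength : HasStrength P p k₀ δ x) (hcross : HasWeakCross P k₀ δ x ε) :
    ∃ b c : ℝ, 0 < b ∧ 0 < c ∧ ∀ᶠ m in atTop, ∀ (D : ℝ) (ω : Ω m),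
      (∀ k ∈ Finset.Icc 1 k₀,
        frobNorm (sampleCov (y m) (n m) k ω - lagCov (P m) (y m) k) ≤ D) →
      estEig k₀ (y m) (n m) 1 ω ≤ k₀ * (b * (p m : ℝ) ^ (1 - δ) + D) ^ 2 ∧
      estEig k₀ (y m) (n m) (r + 1) ω ≤ k₀ * D ^ 2 ∧
      (D ≤ c * (p m : ℝ) ^ (1 - δ) →
        (c * (p m : ℝ) ^ (1 - δ) - D) ^ 2 ≤ estEig k₀ (y m) (n m) r ω) := by
  have h1mem : 1 ∈ Finset.Icc 1 k₀ := Finset.mem_Icc.2 ⟨le_rfl, hk₀⟩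
  have ha0 : ∀ m, 0 ≤ (p m : ℝ) ^ (1 - δ) := fun m => by positivity
  have hb : ∃ b : ℝ, 0 < b ∧ ∀ k ∈ Finset.Icc 1 k₀, ∀ᶠ m in atTop,
      specNorm (lagCov (P m) (x m) k) ≤ b * (p m : ℝ) ^ (1 - δ) := by
    have : ∀ k ∈ Finset.Icc 1 k₀, ∃ b : ℝ, 0 < b ∧ ∀ᶠ m in atTop,
        specNorm (lagCov (P m) (x m) k) ≤ b * (p m : ℝ) ^ (1 - δ) := by
      intro k hk
      obtain ⟨b, hb0, hb⟩ := (hstrength.norm k hk).isBigO.exists_pos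
      refine ⟨b, hb0, hb.bound.mono fun m hm => ?_⟩
      rwa [Real.norm_of_nonneg (specNorm_nonneg _), Real.norm_of_nonneg (ha0 m)] at hm
    choose! b hb0 hb using this
    refine ⟨∑ k ∈ Finset.Icc 1 k₀, b k, Finset.sum_pos hb0 ⟨1, h1mem⟩, fun k hk => ?_⟩
    filter_upwards [hb k hk] with m hm
    refine hm.trans (mul_le_mul_of_nonneg_right ?_ (ha0 m))
    exact Finset.single_le_sum (fun j hj => (hb0 j hj).le) hk
  obtain ⟨b, hb0, hb⟩ := hb
  obtain ⟨C, hC0, hC⟩ := (hstrength.minNorm 1 h1mem).isBigO_symm.exists_pos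
  have hc0 : 0 < C⁻¹ / 2 := by positivity
  have hmin : ∀ᶠ m in atTop,
      C⁻¹ * (p m : ℝ) ^ (1 - δ) ≤ minNorm (lagCov (P m) (x m) 1) := by
    filter_upwards [hC.bound] with m hm
    rw [Real.norm_of_nonneg (ha0 m), Real.norm_of_nonneg (minNorm_nonneg _)] at hm
    rwa [inv_mul_le_iff₀ hC0]
  have hcrossE : ∀ k ∈ Finset.Icc 1 k₀, ∀ e : ℝ, 0 < e → ∀ᶠ m in atTop,
      specNorm (covMat (P m) (x m k) (ε m 0)) ≤ e * (p m : ℝ) ^ (1 - δ) := by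
    intro k hk e he
    have hk' : k ∈ Finset.Icc 0 k₀ := Finset.mem_Icc.2 ⟨Nat.zero_le _, (Finset.mem_Icc.1 hk).2⟩
    filter_upwards [(hcross k hk').def he] with m hm
    rwa [Real.norm_of_nonneg (specNorm_nonneg _), Real.norm_of_nonneg (ha0 m)] at hm
  refine ⟨b + 1, C⁻¹ / 2, by positivity, hc0, ?_⟩
  filter_upwards [(Finset.eventually_all _).2 hb, hmin,
    (Finset.eventually_all _).2 fun k hk => hcrossE k hk 1 one_pos, hcrossE 1 h1mem _ hc0,
    hp.eventually_ge_atTop (r + 1)] with m h1 h2 h3 h4 h5 D ω hD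
  have hA := (hmodel m).orthonormal
  have hS : ∀ k ∈ Finset.Icc 1 k₀, lagCov (P m) (y m) k =
      A m * (lagCov (P m) (x m) k * (A m)ᵀ + covMat (P m) (x m k) (ε m 0)) := fun k hk =>
    lagCov_factorModel (hmodel m) (hfactor m) (Finset.mem_Icc.1 hk).1
  refine ⟨?_, ?_, fun hDc => ?_⟩
  · refine eig_one_sumSq_le (by omega) (lagCov (P m) (y m)) _ _ D (fun k hk v => ?_) hD
    rw [hS k hk]
    refine (euclNorm_lagCov_transpose_le _ hA _ _ v).trans
      (mul_le_mul_of_nonneg_right ?_ (euclNorm_nonneg v))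
    linarith [h1 k hk, h3 k hk]
  · refine eig_succ_sumSq_le h5 (A m) (lagCov (P m) (y m)) _ D (fun k hk v hv => ?_) hD
    rw [hS k hk, Matrix.transpose_mul, ← Matrix.mulVec_mulVec, hv, Matrix.mulVec_zero]
  · refine le_eig_sumSq hr (by omega) hk₀ hA (lagCov (P m) (y m)) _ _ D (fun u => ?_)
      (hD 1 h1mem) hDc
    rw [hS 1 h1mem]
    refine le_trans (mul_le_mul_of_nonneg_right ?_ (euclNorm_nonneg u))
      (le_euclNorm_lagCov_transpose _ hA _ (hstrength.nonsingular 1 h1mem m) _ u)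
    push_cast at h2 h4 ⊢
    linarith

/-- The deviations of the sample autocovariances are `O_P(p / √n)`, with an explicit tail. -/
theorem exists_deviation_tail {P : ∀ m, Measure (Ω m)} [∀ m, IsProbabilityMeasure (P m)]
    {r k₀ : ℕ} {n p : ℕ → ℕ}
    {y : ∀ m, ℤ → Ω m → Fin (p m) → ℝ} {A : ∀ m, Matrix (Fin (p m)) (Fin r) ℝ}
    {x : ∀ m, ℤ → Ω m → Fin r → ℝ} {ε : ∀ m, ℤ → Ω m → Fin (p m) → ℝ}
    (hmodel : ∀ m, IsFactorModel (P m) (y m) (A m) (x m) (ε m))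
    (hmixing : IsMixingArray P y) :
    ∃ H : ℝ, 0 < H ∧ ∀ m, 1 ≤ n m → 1 ≤ p m → ∀ L : ℝ, 0 < L →
      P m {ω | ∀ k ∈ Finset.Icc 1 k₀, frobNorm (sampleCov (y m) (n m) k ω - lagCov (P m) (y m) k) ≤
        L * (p m / √(n m : ℝ))}ᶜ ≤ ENNReal.ofReal (H / L) := by
  obtain ⟨K₁, hK₁⟩ := hmixing.mixing
  obtain ⟨K₂, hK₂⟩ := hmixing.moment
  set K : ℝ≥0 := max K₁ K₂
  have hH : ∀ k : ℕ, 0 ≤ deviationConst k K := fun k => by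
    unfold deviationConst momentBound
    positivity
  refine ⟨1 + ∑ k ∈ Finset.Icc 1 k₀, deviationConst k K,
    add_pos_of_pos_of_nonneg one_pos (Finset.sum_nonneg fun k _ => hH k), fun m hn hp L hL => ?_⟩
  have hsub : {ω | ∀ k ∈ Finset.Icc 1 k₀, frobNorm (sampleCov (y m) (n m) k ω -
      lagCov (P m) (y m) k) ≤ L * (p m / √(n m : ℝ))}ᶜ ⊆
      ⋃ k ∈ Finset.Icc 1 k₀, {ω | L * (p m / √(n m : ℝ)) <
        frobNorm (sampleCov (y m) (n m) k ω - lagCov (P m) (y m) k)} := by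
    intro ω hω
    simpa [and_assoc] using hω
  calc _ ≤ _ := measure_mono hsub
    _ ≤ ∑ k ∈ Finset.Icc 1 k₀, P m {ω | L * (p m / √(n m : ℝ)) <
        frobNorm (sampleCov (y m) (n m) k ω - lagCov (P m) (y m) k)} :=
      measure_biUnion_finset_le _ _
    _ ≤ ∑ k ∈ Finset.Icc 1 k₀, ENNReal.ofReal (deviationConst k K / L) :=
      Finset.sum_le_sum fun k _ => measure_frobNorm_gt_le (P m) (hmodel m).measurable
        (hmixing.stationary m) (K := K)
        ((hK₁ m).trans (ENNReal.coe_le_coe.2 (le_max_left _ _)))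
        (fun t i => (hK₂ m t i).trans (ENNReal.coe_le_coe.2 (le_max_right _ _))) k (n m) hn hp L hL
    _ = ENNReal.ofReal (∑ k ∈ Finset.Icc 1 k₀, deviationConst k K / L) :=
      (ENNReal.ofReal_sum_of_nonneg fun k _ => div_nonneg (hH k) hL.le).symm
    _ ≤ _ := by
      rw [← Finset.sum_div]
      exact ENNReal.ofReal_le_ofReal (by gcongr; linarith)

end Array

end FactorTS

/-! ### Ratios of the estimated eigenvalues -/

theorem corollary1 {Ω : ℕ → Type*} [∀ m, MeasurableSpace (Ω m)]
    (P : ∀ m, Measure (Ω m)) [∀ m, IsProbabilityMeasure (P m)]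
    (r k₀ : ℕ) (hr : 1 ≤ r) (hk₀ : 1 ≤ k₀) (δ : ℝ) (hδ : δ ∈ Set.Icc (0 : ℝ) 1)
    (n p : ℕ → ℕ) (hn : Tendsto n atTop atTop) (hp : Tendsto p atTop atTop)
    (y : ∀ m, ℤ → Ω m → Fin (p m) → ℝ) (A : ∀ m, Matrix (Fin (p m)) (Fin r) ℝ)
    (x : ∀ m, ℤ → Ω m → Fin r → ℝ) (ε : ∀ m, ℤ → Ω m → Fin (p m) → ℝ)
    (hmodel : ∀ m, FactorTS.IsFactorModel (P m) (y m) (A m) (x m) (ε m))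
    (hfactor : ∀ m, FactorTS.IsStationaryFactor (P m) (x m) (ε m))
    (hmixing : FactorTS.IsMixingArray P y)
    (heig : ∀ m, FactorTS.HasDistinctEig (P m) k₀ r (y m))
    (hstrength : FactorTS.HasStrength P p k₀ δ x)
    (hcross : FactorTS.HasWeakCross P k₀ δ x ε)
    (hh : Tendsto (fun m => (p m : ℝ) ^ δ / √(n m : ℝ)) atTop (𝓝 0)) :
    (∀ j, 1 ≤ j → j ≤ r → FactorTS.WithProbTendingToOne P
      (fun m => {ω | 0 < FactorTS.estEig k₀ (y m) (n m) j ω})) ∧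
    (∀ j, 1 ≤ j → j ≤ r - 1 → FactorTS.IsOrderOne P
      (fun m ω => FactorTS.estEig k₀ (y m) (n m) (j + 1) ω /
        FactorTS.estEig k₀ (y m) (n m) j ω)) ∧
    FactorTS.IsBigOP P
      (fun m ω => FactorTS.estEig k₀ (y m) (n m) (r + 1) ω /
        FactorTS.estEig k₀ (y m) (n m) r ω)
      (fun m => (p m : ℝ) ^ (2 * δ) / (n m : ℝ)) ∧
    FactorTS.TendstoZeroInProb P
      (fun m ω => FactorTS.estEig k₀ (y m) (n m) (r + 1) ω /
        FactorTS.estEig k₀ (y m) (n m) r ω) := by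
  have hδ0 := hδ.1
  have ha0 : ∀ᶠ m in atTop, 0 < (p m : ℝ) ^ (1 - δ) := by
    filter_upwards [hp.eventually_ge_atTop 1] with m hm
    exact Real.rpow_pos_of_pos (by exact_mod_cast hm) _
  have hk0 : (0 : ℝ) < k₀ := by exact_mod_cast hk₀
  -- The deviations are of order `p / √n`, which is `h` times the factor strength `p^{1-δ}`.
  have hscale : ∀ᶠ m in atTop, (p m : ℝ) / √(n m : ℝ) =
      (p m : ℝ) ^ δ / √(n m : ℝ) * (p m : ℝ) ^ (1 - δ) := by
    filter_upwards [hp.eventually_ge_atTop 1] with m hm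
    have hp0 : (0 : ℝ) < p m := by exact_mod_cast hm
    have : (p m : ℝ) ^ δ * (p m : ℝ) ^ (1 - δ) = p m := by
      rw [← Real.rpow_add hp0, add_sub_cancel, Real.rpow_one]
    rw [div_mul_eq_mul_div, this]
  have hrate : ∀ m, (p m : ℝ) ^ (2 * δ) / (n m : ℝ) = ((p m : ℝ) ^ δ / √(n m : ℝ)) ^ 2 := by
    intro m
    rw [div_pow, Real.sq_sqrt (Nat.cast_nonneg _), mul_comm, Real.rpow_mul (Nat.cast_nonneg _)]
    norm_num
  obtain ⟨b, c, hb, hc, hdet⟩ := FactorTS.eventually_estEig_bounds hr hk₀ n hp hmodel hfactor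
    hstrength hcross
  obtain ⟨H, hH, htail⟩ := FactorTS.exists_deviation_tail (k₀ := k₀) (n := n) hmodel hmixing
  -- With probability tending to one, the deviations are below `c/2` times the factor strength.
  have hgood : FactorTS.WithProbTendingToOne P (fun m => {ω | ∀ k ∈ Finset.Icc 1 k₀,
      FactorTS.frobNorm (FactorTS.sampleCov (y m) (n m) k ω - FactorTS.lagCov (P m) (y m) k) ≤
        c / 2 * (p m : ℝ) ^ (1 - δ)}) := by
    have hlim : Tendsto (fun m => ENNReal.ofReal
        (H / (c / 2) * ((p m : ℝ) ^ δ / √(n m : ℝ)))) atTop (𝓝 0) := by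
      have := ENNReal.tendsto_ofReal (hh.const_mul (H / (c / 2)))
      simpa using this
    refine tendsto_of_tendsto_of_tendsto_of_le_of_le' tendsto_const_nhds hlim
      (Eventually.of_forall fun _ => zero_le) ?_
    filter_upwards [hscale, hn.eventually_ge_atTop 1, hp.eventually_ge_atTop 1] with m h1 h2 h3
    have hp0 : (0 : ℝ) < p m := by exact_mod_cast h3
    have hn0 : (0 : ℝ) < √(n m : ℝ) := Real.sqrt_pos.2 (by exact_mod_cast h2)
    have hh0 : 0 < (p m : ℝ) ^ δ / √(n m : ℝ) := by positivity
    have := htail m h2 h3 (c / 2 / ((p m : ℝ) ^ δ / √(n m : ℝ))) (by positivity)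
    have e1 : c / 2 / ((p m : ℝ) ^ δ / √(n m : ℝ)) * ((p m : ℝ) / √(n m : ℝ)) =
        c / 2 * (p m : ℝ) ^ (1 - δ) := by
      rw [h1, ← mul_assoc, div_mul_cancel₀ _ hh0.ne']
    rwa [e1, div_div_eq_mul_div, mul_div_right_comm] at this
  -- On that event all `r` leading eigenvalues lie between two multiples of `p^{2-2δ}`.
  have hlow : ∀ᶠ m in atTop, ∀ ω, (∀ k ∈ Finset.Icc 1 k₀,
      FactorTS.frobNorm (FactorTS.sampleCov (y m) (n m) k ω - FactorTS.lagCov (P m) (y m) k) ≤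
        c / 2 * (p m : ℝ) ^ (1 - δ)) → ∀ j, 1 ≤ j → j ≤ r →
      (c / 2) ^ 2 * ((p m : ℝ) ^ (1 - δ)) ^ 2 ≤ FactorTS.estEig k₀ (y m) (n m) j ω ∧
      FactorTS.estEig k₀ (y m) (n m) j ω ≤ k₀ * (b + c / 2) ^ 2 * ((p m : ℝ) ^ (1 - δ)) ^ 2 := by
    filter_upwards [hdet, ha0, hp.eventually_ge_atTop (r + 1)] with m h1 h2 h3 ω hω j hj hjr
    obtain ⟨u1, -, u3⟩ := h1 _ ω hω
    have u4 := u3 (by nlinarith)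
    constructor
    · refine le_trans (le_of_eq ?_) (u4.trans (FactorTS.eig_antitone _ hj hjr (by omega)))
      ring
    · refine (FactorTS.eig_antitone _ le_rfl hj (by omega)).trans (u1.trans (le_of_eq ?_))
      ring
  have hbig : FactorTS.IsBigOP P
      (fun m ω => FactorTS.estEig k₀ (y m) (n m) (r + 1) ω /
        FactorTS.estEig k₀ (y m) (n m) r ω)
      (fun m => (p m : ℝ) ^ (2 * δ) / (n m : ℝ)) := by
    intro η hη
    by_cases htop : η = ∞
    · exact ⟨0, Eventually.of_forall fun m => htop ▸ le_top⟩
    have hη0 : 0 < η.toReal := ENNReal.toReal_pos hη.ne' htop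
    -- This `L` makes the tail bound `H / L` equal to half of `η`.
    set L := 2 * H / η.toReal with hL
    have hL0 : 0 < L := by positivity
    have hhalf : ENNReal.ofReal (H / L) = η / 2 := by
      have : H / L = η.toReal / 2 := by rw [hL]; field_simp
      rw [this, ENNReal.ofReal_div_of_pos two_pos, ENNReal.ofReal_toReal htop]
      norm_num
    refine ⟨k₀ * L ^ 2 / (c / 2) ^ 2, ?_⟩
    filter_upwards [hdet, ha0, hscale, hlow, hn.eventually_ge_atTop 1, hp.eventually_ge_atTop 1,
      (ENNReal.tendsto_nhds_zero.1 hgood) (η / 2) (ENNReal.half_pos hη.ne')]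
      with m h1 h2 h3 h4 h5 h6 h7
    rw [← ENNReal.add_halves η]
    refine le_trans (measure_mono ?_) ((measure_union_le _ _).trans
      (add_le_add h7 ((htail m h5 h6 L hL0).trans_eq hhalf)))
    intro ω hω
    by_contra hcon
    rw [Set.mem_union, not_or, Set.notMem_compl_iff, Set.notMem_compl_iff] at hcon
    obtain ⟨g1, g2⟩ := hcon
    have l1 := (h4 ω g1 r hr le_rfl).1
    have l2 := (h1 _ ω g2).2.1
    have l0 : 0 ≤ FactorTS.estEig k₀ (y m) (n m) (r + 1) ω := FactorTS.eig_sumSq_nonneg _ _ _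
    have lpos : 0 < FactorTS.estEig k₀ (y m) (n m) r ω := lt_of_lt_of_le (by positivity) l1
    rw [Set.mem_ofPred_eq] at hω
    refine not_le.2 hω ?_
    rw [abs_of_nonneg (div_nonneg l0 lpos.le), hrate, abs_of_nonneg (sq_nonneg _)]
    rw [h3] at l2
    calc FactorTS.estEig k₀ (y m) (n m) (r + 1) ω / FactorTS.estEig k₀ (y m) (n m) r ω
        ≤ k₀ * (L * ((p m : ℝ) ^ δ / √(n m : ℝ) * (p m : ℝ) ^ (1 - δ))) ^ 2 /
            ((c / 2) ^ 2 * ((p m : ℝ) ^ (1 - δ)) ^ 2) :=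
          div_le_div₀ (by positivity) l2 (by positivity) l1
      _ = _ := by field_simp
  have hrate0 : Tendsto (fun m => (p m : ℝ) ^ (2 * δ) / (n m : ℝ)) atTop (𝓝 0) := by
    simp only [hrate]
    simpa using hh.pow 2
  refine ⟨fun j hj hjr => hgood.mono ?_, fun j hj hjr => ?_, hbig, hbig.tendstoZeroInProb hrate0⟩
  · filter_upwards [hlow, ha0] with m h1 h2 ω hω
    exact lt_of_lt_of_le (by positivity) (h1 ω hω j hj hjr).1
  · have hlc : 0 < (c / 2) ^ 2 / (k₀ * (b + c / 2) ^ 2) := by positivity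
    have hle : (c / 2) ^ 2 / (k₀ * (b + c / 2) ^ 2) ≤ 1 := by
      rw [div_le_one (by positivity)]
      have h1 : (1 : ℝ) ≤ k₀ := by exact_mod_cast hk₀
      nlinarith [mul_pos hb hc, sq_nonneg (b + c / 2), sq_nonneg b]
    refine ⟨_, 1, hlc, hle, hgood.mono ?_⟩
    filter_upwards [hlow, ha0, hp.eventually_ge_atTop (r + 1)] with m h1 h2 h3 ω hω
    have l1 := h1 ω hω j hj (by omega)
    have l2 := h1 ω hω (j + 1) (by omega) (by omega)
    have lpos : 0 < FactorTS.estEig k₀ (y m) (n m) j ω := lt_of_lt_of_le (by positivity) l1.1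
    constructor
    · rw [le_div_iff₀ lpos]
      refine le_trans ?_ l2.1
      calc (c / 2) ^ 2 / (k₀ * (b + c / 2) ^ 2) * FactorTS.estEig k₀ (y m) (n m) j ω
          ≤ (c / 2) ^ 2 / (k₀ * (b + c / 2) ^ 2) *
              (k₀ * (b + c / 2) ^ 2 * ((p m : ℝ) ^ (1 - δ)) ^ 2) :=
            mul_le_mul_of_nonneg_left l1.2 hlc.le
        _ = _ := by field_simp
    · rw [div_le_one lpos]
      exact FactorTS.eig_antitone _ hj (by omega) (by omega)
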